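/- Let $K$ be a characteristic zero local field (a finite extension of some $\mathbb{Q}_p$), with ring of integers $\mathcal{O}$ and absolute value $|\cdot|$. For a complete discrete valuation field $L$ with valuation $v_L$ and valuation ideals $\mathfrak{p}_L^c=\{y\in L : v_L(y)\ge c\}$, let $L\{\{t\}\}$ be the field of series $\sum_{i\in\mathbb{Z}}x_it^i$ with $x_i\in L$, $\inf_i v_L(x_i)>-\infty$ and $x_i\to 0$ as $i\to-\infty$, with the product $(xy)_k=\sum_i x_iy_{k-i}$ and the valuation $\inf_i v_L(x_i)$; let $L((t))$ be the field of formal Laurent series over $L$. For $n\ge 1$ and $0\le r\le n-1$ let $$F=K\{\{t_1\}\}\cdots\{\{t_r\}\}((t_{r+1}))\cdots((t_{n-1})).$$ The field $F$ carries the higher topology, defined inductively. The field $K$ has its usual topology. If $L$ has been topologised, a basis of neighbourhoods of zero of $L\{\{t\}\}$ is given by the sets $\sum_i M_it^i=\{\sum_i x_it^i : x_i\in M_i \text{ for all } i\}$, where the $M_i$ are open $\mathcal{O}$-submodules of $L$ such that some $\mathfrak{p}_L^c$ is contained in all the $M_i$, and such that for every $l\in\mathbb{Z}$ one has $\mathfrak{p}_L^l\subset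 M_i$ for all sufficiently large $i$. A basis of neighbourhoods of zero of $L((t))$ is given by the sets $\{\sum_i x_it^i\in L((t)) : x_i\in M_i\text{ for all } i\}$, where the $M_i$ are open $\mathcal{O}$-submodules of $L$ with $M_i=L$ for all sufficiently large $i$. A topological $K$-vector space $E$ is locally convex if its open $\mathcal{O}$-submodules form a basis of neighbourhoods of zero. An $\mathcal{O}$-submodule $A\subset E$ is compactoid if for every open $\mathcal{O}$-submodule $\Lambda\subset E$ there are $v_1,\dots,v_m\in E$ with $A\subset\Lambda+\mathcal{O}v_1+\cdots+\mathcal{O}v_m$. Let $F'_c$ be the space of continuous $K$-linear forms $F\to K$ with the topology of uniform convergence on the compactoid $\mathcal{O}$-submodules of $F$. Let $\pi_0:F\to K$ send a series $\sum_\alpha x(\alpha)t^\alpha$, $\alpha\in\mathbb{Z}^{n-1}$, to its coefficient $x(0,\dots,0)$, and for $x\in F$ let $\pi_x:F\to K$, $\pi_x(y)=\pi_0(xy)$. **Theorem.** $F$ and $F'_c$ are locally convex $K$-vector spaces, every $\pi_x$ is continuous, and the map $\gamma:F\to F'_c$, $x\mapsto\pi_x$, is an isomorphism of locally convex $K$-vector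 spaces, that is, a $K$-linear homeomorphism. -/

import Mathlib

open Filter Topology

noncomputable section

set_option linter.unusedSectionVars false

namespace HigherLocalField

universe u

/-! ### The ring of series `R{{t}}` -/

section Curly

variable (R : Type u) [NormedCommRing R]

/-- The bounded families `(x i)` of elements of `R` indexed by `i : ℤ`
with `x i → 0` as `i → -∞`. -/
def curlySubgroup : AddSubgroup (BoundedContinuousFunction ℤ R) where
  carrier := {f | Tendsto f atBot (𝓝 0)}
  zero_mem' := by
    change Tendsto (fun _ : ℤ => (0 : R)) atBot (𝓝 0)
    exact tendsto_const_nhds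
  add_mem' := by
    intro a b ha hb
    have h := Tendsto.add (show Tendsto a atBot (𝓝 0) from ha) (show Tendsto b atBot (𝓝 0) from hb)
    rw [add_zero] at h
    exact h
  neg_mem' := by
    intro a ha
    have h := Tendsto.neg (show Tendsto a atBot (𝓝 0) from ha)
    rw [neg_zero] at h
    exact h

/-- `R{{t}}`: the set of formal series `∑ x i * t ^ i`, over all `i : ℤ`, with bounded
coefficients in `R` such that `x i → 0` as `i → -∞`.
It is given the sup norm `‖x‖ = sup ‖x i‖`, which is the absolute value of the discrete valuation
`inf v (x i)` if `R` is a complete discrete valuation field with valuation `v`. -/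
def Curly : Type u := curlySubgroup R

instance : NormedAddCommGroup (Curly R) :=
  inferInstanceAs (NormedAddCommGroup (curlySubgroup R))

variable {R}

namespace Curly

/-- The coefficient of `t ^ i`. -/
def coeff (x : Curly R) (i : ℤ) : R := x.1 i

@[ext] theorem ext {x y : Curly R} (h : ∀ i, x.coeff i = y.coeff i) : x = y :=
  Subtype.ext (DFunLike.ext _ _ h)

theorem tendsto_coeff (x : Curly R) : Tendsto x.coeff atBot (𝓝 0) := x.2

theorem norm_coeff_le (x : Curly R) (i : ℤ) : ‖x.coeff i‖ ≤ ‖x‖ := x.1.norm_coe_le_norm i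

theorem norm_le {x : Curly R} {C : ℝ} (hC : 0 ≤ C) : ‖x‖ ≤ C ↔ ∀ i, ‖x.coeff i‖ ≤ C :=
  BoundedContinuousFunction.norm_le hC

@[simp] theorem coeff_add (x y : Curly R) (i : ℤ) : (x + y).coeff i = x.coeff i + y.coeff i := rfl

@[simp] theorem coeff_zero (i : ℤ) : (0 : Curly R).coeff i = 0 := rfl

@[simp] theorem coeff_neg (x : Curly R) (i : ℤ) : (-x).coeff i = -x.coeff i := rfl

@[simp] theorem coeff_sub (x y : Curly R) (i : ℤ) : (x - y).coeff i = x.coeff i - y.coeff i := rfl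

/-- The series with a given bounded family of coefficients tending to `0` at `-∞`. -/
def mk (f : ℤ → R) (C : ℝ) (hC : ∀ i, ‖f i‖ ≤ C) (hf : Tendsto f atBot (𝓝 0)) : Curly R :=
  ⟨BoundedContinuousFunction.ofNormedAddCommGroupDiscrete f C hC, hf⟩

@[simp] theorem coeff_mk (f : ℤ → R) (C : ℝ) (hC : ∀ i, ‖f i‖ ≤ C)
    (hf : Tendsto f atBot (𝓝 0)) (i : ℤ) : (mk f C hC hf).coeff i = f i := rfl

instance [CompleteSpace R] : CompleteSpace (Curly R) := by
  have hcl : IsClosed (curlySubgroup R : Set (BoundedContinuousFunction ℤ R)) := by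
    refine isClosed_of_closure_subset fun f hf => ?_
    change Tendsto f atBot (𝓝 0)
    rw [Metric.tendsto_nhds]
    intro ε hε
    obtain ⟨g, hg, hfg⟩ := Metric.mem_closure_iff.1 hf (ε / 2) (half_pos hε)
    have hg' : Tendsto g atBot (𝓝 0) := hg
    filter_upwards [Metric.tendsto_nhds.1 hg' (ε / 2) (half_pos hε)] with i hi
    have h1 := BoundedContinuousFunction.dist_coe_le_dist (f := f) (g := g) i
    have h2 := dist_triangle (f i) (g i) 0
    linarith
  exact hcl.completeSpace_coe

instance [IsUltrametricDist R] : IsUltrametricDist (Curly R) := by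
  refine IsUltrametricDist.isUltrametricDist_of_forall_norm_add_le_max_norm fun x y => ?_
  rw [norm_le (le_max_of_le_left (norm_nonneg x))]
  intro i
  exact (IsUltrametricDist.norm_add_le_max _ _).trans
    (max_le_max (norm_coeff_le x i) (norm_coeff_le y i))

theorem tendsto_single (a : R) : Tendsto (Pi.single (0 : ℤ) a : ℤ → R) atBot (𝓝 0) := by
  refine Tendsto.congr' ?_ tendsto_const_nhds
  filter_upwards [Iio_mem_atBot (0 : ℤ)] with i hi
  exact (Pi.single_eq_of_ne (M := fun _ => R) (ne_of_lt hi) a).symm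

/-- The constant series with value `a`. -/
def const (a : R) : Curly R :=
  mk (Pi.single (0 : ℤ) a) ‖a‖ (fun i => by
    rcases eq_or_ne i 0 with rfl | h
    · simp
    · simp [Pi.single_eq_of_ne h]) (tendsto_single a)

theorem coeff_const_zero (a : R) : (const a).coeff 0 = a := Pi.single_eq_same (M := fun _ => R) (0 : ℤ) a

theorem coeff_const_of_ne (a : R) {i : ℤ} (h : i ≠ 0) : (const a).coeff i = 0 :=
  Pi.single_eq_of_ne (M := fun _ => R) h a

theorem exists_small (x : Curly R) {ε : ℝ} (hε : 0 < ε) :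
    ∃ N : ℤ, ∀ i, i < N → ‖x.coeff i‖ < ε := by
  have h := Metric.tendsto_nhds.1 x.tendsto_coeff ε hε
  obtain ⟨N, hN⟩ := eventually_atBot.1 h
  exact ⟨N, fun i hi => by simpa using hN i hi.le⟩

variable [IsUltrametricDist R] [CompleteSpace R]

theorem summable_triple (x y z : Curly R) (k : ℤ) :
    Summable (fun q : ℤ × ℤ => x.coeff q.2 * y.coeff (q.1 - q.2) * z.coeff (k - q.1)) := by
  refine NonarchimedeanAddGroup.summable_of_tendsto_cofinite_zero ?_
  rw [Metric.tendsto_nhds]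
  intro ε hε
  have hB : 0 < (‖x‖ + 1) * (‖y‖ + 1) * (‖z‖ + 1) := by positivity
  set B := (‖x‖ + 1) * (‖y‖ + 1) * (‖z‖ + 1) with hBdef
  obtain ⟨N₁, h₁⟩ := x.exists_small (div_pos hε hB)
  obtain ⟨N₂, h₂⟩ := y.exists_small (div_pos hε hB)
  obtain ⟨N₃, h₃⟩ := z.exists_small (div_pos hε hB)
  rw [eventually_cofinite]
  refine ((Set.finite_Icc (N₁ + N₂) (k - N₃)).prod (Set.finite_Icc N₁ (k - N₃ - N₂))).subset ?_
  rintro ⟨m, i⟩ hmi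
  simp only [dist_zero_right, Set.mem_ofPred_eq, not_lt] at hmi
  have hprod : ‖x.coeff i * y.coeff (m - i) * z.coeff (k - m)‖
      ≤ ‖x.coeff i‖ * ‖y.coeff (m - i)‖ * ‖z.coeff (k - m)‖ :=
    (norm_mul_le _ _).trans (mul_le_mul_of_nonneg_right (norm_mul_le _ _) (norm_nonneg _))
  have hx := x.norm_coeff_le i
  have hy := y.norm_coeff_le (m - i)
  have hz := z.norm_coeff_le (k - m)
  have nx := norm_nonneg (x.coeff i)
  have ny := norm_nonneg (y.coeff (m - i))
  have nz := norm_nonneg (z.coeff (k - m))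
  have Nx := norm_nonneg x
  have Ny := norm_nonneg y
  have Nz := norm_nonneg z
  have e₁ : N₁ ≤ i := by
    by_contra! h
    have h' := (lt_div_iff₀ hB).1 (h₁ i h)
    have : ‖x.coeff i‖ * ‖y.coeff (m - i)‖ * ‖z.coeff (k - m)‖ ≤ ‖x.coeff i‖ * B := by
      rw [hBdef]
      calc ‖x.coeff i‖ * ‖y.coeff (m - i)‖ * ‖z.coeff (k - m)‖
          = ‖x.coeff i‖ * (1 * ‖y.coeff (m - i)‖ * ‖z.coeff (k - m)‖) := by ring
        _ ≤ ‖x.coeff i‖ * ((‖x‖ + 1) * (‖y‖ + 1) * (‖z‖ + 1)) := by gcongr <;> linarith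
    linarith
  have e₂ : N₂ ≤ m - i := by
    by_contra! h
    have h' := (lt_div_iff₀ hB).1 (h₂ _ h)
    have : ‖x.coeff i‖ * ‖y.coeff (m - i)‖ * ‖z.coeff (k - m)‖ ≤ ‖y.coeff (m - i)‖ * B := by
      rw [hBdef]
      calc ‖x.coeff i‖ * ‖y.coeff (m - i)‖ * ‖z.coeff (k - m)‖
          = ‖y.coeff (m - i)‖ * (‖x.coeff i‖ * 1 * ‖z.coeff (k - m)‖) := by ring
        _ ≤ ‖y.coeff (m - i)‖ * ((‖x‖ + 1) * (‖y‖ + 1) * (‖z‖ + 1)) := by gcongr <;> linarith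
    linarith
  have e₃ : N₃ ≤ k - m := by
    by_contra! h
    have h' := (lt_div_iff₀ hB).1 (h₃ _ h)
    have : ‖x.coeff i‖ * ‖y.coeff (m - i)‖ * ‖z.coeff (k - m)‖ ≤ ‖z.coeff (k - m)‖ * B := by
      rw [hBdef]
      calc ‖x.coeff i‖ * ‖y.coeff (m - i)‖ * ‖z.coeff (k - m)‖
          = ‖z.coeff (k - m)‖ * (‖x.coeff i‖ * ‖y.coeff (m - i)‖ * 1) := by ring
        _ ≤ ‖z.coeff (k - m)‖ * ((‖x‖ + 1) * (‖y‖ + 1) * (‖z‖ + 1)) := by gcongr <;> linarith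
    linarith
  exact ⟨⟨by simp only; omega, by simp only; omega⟩, ⟨by simp only; omega, by simp only; omega⟩⟩

theorem summable_mul (x y : Curly R) (k : ℤ) :
    Summable (fun i : ℤ => x.coeff i * y.coeff (k - i)) := by
  refine NonarchimedeanAddGroup.summable_of_tendsto_cofinite_zero ?_
  rw [Metric.tendsto_nhds]
  intro ε hε
  have hB : 0 < (‖x‖ + 1) * (‖y‖ + 1) := by positivity
  obtain ⟨N₁, h₁⟩ := x.exists_small (div_pos hε (show 0 < ‖y‖ + 1 by positivity))
  obtain ⟨N₂, h₂⟩ := y.exists_small (div_pos hε (show 0 < ‖x‖ + 1 by positivity))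
  rw [eventually_cofinite]
  refine (Set.finite_Icc N₁ (k - N₂)).subset ?_
  intro i hi
  simp only [dist_zero_right, Set.mem_ofPred_eq, not_lt] at hi
  have hprod := norm_mul_le (x.coeff i) (y.coeff (k - i))
  have hx := x.norm_coeff_le i
  have hy := y.norm_coeff_le (k - i)
  have e₁ : N₁ ≤ i := by
    by_contra! h
    have h' := (lt_div_iff₀ (show 0 < ‖y‖ + 1 by positivity)).1 (h₁ i h)
    have : ‖x.coeff i‖ * ‖y.coeff (k - i)‖ ≤ ‖x.coeff i‖ * (‖y‖ + 1) := by gcongr; linarith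
    linarith
  have e₂ : N₂ ≤ k - i := by
    by_contra! h
    have h' := (lt_div_iff₀ (show 0 < ‖x‖ + 1 by positivity)).1 (h₂ _ h)
    have : ‖x.coeff i‖ * ‖y.coeff (k - i)‖ ≤ (‖x‖ + 1) * ‖y.coeff (k - i)‖ := by gcongr; linarith
    linarith
  exact ⟨e₁, by omega⟩

theorem norm_mulCoeff_le (x y : Curly R) (k : ℤ) :
    ‖∑' i : ℤ, x.coeff i * y.coeff (k - i)‖ ≤ ‖x‖ * ‖y‖ :=
  IsUltrametricDist.norm_tsum_le_of_forall_le_of_nonneg (by positivity) fun i =>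
    (norm_mul_le _ _).trans
      (mul_le_mul (norm_coeff_le x i) (norm_coeff_le y _) (norm_nonneg _) (norm_nonneg _))

theorem tendsto_mulCoeff (x y : Curly R) :
    Tendsto (fun k : ℤ => ∑' i : ℤ, x.coeff i * y.coeff (k - i)) atBot (𝓝 0) := by
  rw [Metric.tendsto_nhds]
  intro ε hε
  have hε2 := half_pos hε
  obtain ⟨N₁, h₁⟩ := x.exists_small (div_pos hε2 (show 0 < ‖y‖ + 1 by positivity))
  obtain ⟨N₂, h₂⟩ := y.exists_small (div_pos hε2 (show 0 < ‖x‖ + 1 by positivity))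
  filter_upwards [Iio_mem_atBot (N₁ + N₂)] with k hk
  rw [dist_zero_right]
  refine lt_of_le_of_lt ?_ (half_lt_self hε)
  refine IsUltrametricDist.norm_tsum_le_of_forall_le_of_nonneg hε2.le fun i => ?_
  refine (norm_mul_le _ _).trans ?_
  have hx := x.norm_coeff_le i
  have hy := y.norm_coeff_le (k - i)
  have nx := norm_nonneg (x.coeff i)
  have ny := norm_nonneg (y.coeff (k - i))
  by_cases h : i < N₁
  · have h' := (lt_div_iff₀ (show 0 < ‖y‖ + 1 by positivity)).1 (h₁ i h)
    have : ‖x.coeff i‖ * ‖y.coeff (k - i)‖ ≤ ‖x.coeff i‖ * (‖y‖ + 1) := by gcongr; linarith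
    linarith
  · have hk' : k < N₁ + N₂ := hk
    have h' := (lt_div_iff₀ (show 0 < ‖x‖ + 1 by positivity)).1 (h₂ (k - i) (by omega))
    have : ‖x.coeff i‖ * ‖y.coeff (k - i)‖ ≤ (‖x‖ + 1) * ‖y.coeff (k - i)‖ := by gcongr; linarith
    linarith

/-- Multiplication of series: the `k`-th coefficient of `x * y` is the sum of the convergent series
`∑ x i * y (k - i)` in `R`. -/
instance : Mul (Curly R) where
  mul x y := mk (fun k => ∑' i : ℤ, x.coeff i * y.coeff (k - i)) (‖x‖ * ‖y‖)
    (norm_mulCoeff_le x y) (tendsto_mulCoeff x y)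

theorem coeff_mul (x y : Curly R) (k : ℤ) :
    (x * y).coeff k = ∑' i : ℤ, x.coeff i * y.coeff (k - i) := rfl

theorem coeff_const_mul (a : R) (x : Curly R) (k : ℤ) : (const a * x).coeff k = a * x.coeff k := by
  rw [coeff_mul, tsum_eq_single 0]
  · rw [coeff_const_zero, sub_zero]
  · intro i hi
    rw [coeff_const_of_ne a hi, zero_mul]

theorem mul_comm' (x y : Curly R) : x * y = y * x := by
  ext k
  rw [coeff_mul, coeff_mul, ← (Equiv.subLeft k).tsum_eq]
  refine tsum_congr fun i => ?_
  simp only [Equiv.subLeft_apply, sub_sub_cancel]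
  exact mul_comm _ _

theorem mul_assoc' (x y z : Curly R) : x * y * z = x * (y * z) := by
  ext k
  have hL : (x * y * z).coeff k =
      ∑' (m : ℤ) (i : ℤ), x.coeff i * y.coeff (m - i) * z.coeff (k - m) := by
    rw [coeff_mul]
    refine tsum_congr fun m => ?_
    rw [coeff_mul, Summable.tsum_mul_right _ (summable_mul x y m)]
  have hR : (x * (y * z)).coeff k =
      ∑' (i : ℤ) (m : ℤ), x.coeff i * y.coeff (m - i) * z.coeff (k - m) := by
    rw [coeff_mul]
    refine tsum_congr fun i => ?_
    rw [coeff_mul, ← Summable.tsum_mul_left _ (summable_mul y z (k - i)),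
      ← (Equiv.subRight i).tsum_eq]
    refine tsum_congr fun m => ?_
    simp only [Equiv.subRight_apply, mul_assoc, sub_sub_sub_cancel_right]
  rw [hL, hR]
  have hs : Summable (Function.uncurry
      fun m i : ℤ => x.coeff i * y.coeff (m - i) * z.coeff (k - m)) := summable_triple x y z k
  exact hs.tsum_comm.symm

theorem mul_add' (x y z : Curly R) : x * (y + z) = x * y + x * z := by
  ext k
  rw [coeff_add, coeff_mul, coeff_mul, coeff_mul,
    ← Summable.tsum_add (summable_mul x y k) (summable_mul x z k)]
  exact tsum_congr fun i => by rw [coeff_add, mul_add]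

theorem const_one_mul (x : Curly R) : const 1 * x = x := by
  ext k
  rw [coeff_const_mul, one_mul]

theorem zero_mul' (x : Curly R) : 0 * x = 0 := by
  ext k
  simp [coeff_mul]

theorem norm_mul_le' (x y : Curly R) : ‖x * y‖ ≤ ‖x‖ * ‖y‖ :=
  (norm_le (by positivity)).2 fun k => norm_mulCoeff_le x y k

instance : CommRing (Curly R) :=
  { (inferInstance : AddCommGroup (Curly R)), (inferInstance : Mul (Curly R)) with
    one := const 1
    mul_assoc := mul_assoc'
    mul_comm := mul_comm'
    one_mul := const_one_mul
    mul_one := fun x => (mul_comm' x (const 1)).trans (const_one_mul x)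
    left_distrib := mul_add'
    right_distrib := fun x y z => by
      rw [mul_comm', mul_add', mul_comm' z x, mul_comm' z y]
    zero_mul := zero_mul'
    mul_zero := fun x => (mul_comm' x 0).trans (zero_mul' x) }

instance : NormedCommRing (Curly R) :=
  { (inferInstance : NormedAddCommGroup (Curly R)), (inferInstance : CommRing (Curly R)) with
    norm_mul_le := norm_mul_le' }

theorem one_def : (1 : Curly R) = const 1 := rfl

variable (R) in
/-- The embedding `R → R{{t}}` as constant series. -/
def constHom : R →+* Curly R where
  toFun := const
  map_one' := rfl
  map_mul' := fun a b => by
    ext k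
    rw [coeff_const_mul]
    rcases eq_or_ne k 0 with rfl | h
    · simp only [coeff_const_zero]
    · simp only [coeff_const_of_ne _ h, mul_zero]
  map_zero' := by
    ext k
    rcases eq_or_ne k 0 with rfl | h
    · rw [coeff_const_zero, coeff_zero]
    · rw [coeff_const_of_ne _ h, coeff_zero]
  map_add' := fun a b => by
    ext k
    rw [coeff_add]
    rcases eq_or_ne k 0 with rfl | h
    · simp only [coeff_const_zero]
    · simp only [coeff_const_of_ne _ h, add_zero]

section Algebra

variable (K : Type*) [NormedField K] [NormedAlgebra K R]

/-- The `K`-algebra structure given by constant series. -/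
instance : Algebra K (Curly R) := ((constHom R).comp (algebraMap K R)).toAlgebra

variable {K} in
@[simp] theorem coeff_smul (c : K) (x : Curly R) (i : ℤ) : (c • x).coeff i = c • x.coeff i := by
  rw [Algebra.smul_def c (x.coeff i)]
  exact coeff_const_mul (algebraMap K R c) x i

instance : NormedAlgebra K (Curly R) where
  norm_smul_le := fun c x => by
    refine (norm_le (by positivity)).2 fun i => ?_
    rw [coeff_smul]
    exact (norm_smul_le c _).trans (mul_le_mul_of_nonneg_left (norm_coeff_le x i) (norm_nonneg c))

/-- Taking the `i`-th coefficient, as a `K`-linear map. -/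
def coeffHom (i : ℤ) : Curly R →ₗ[K] R where
  toFun := fun x => x.coeff i
  map_add' := fun _ _ => rfl
  map_smul' := fun c x => coeff_smul c x i

end Algebra

end Curly

end Curly

/-! ### Ring of integers, lattices, locally convex spaces, compactoids, the c-topology -/

section LocallyConvex

variable (K : Type u) [NontriviallyNormedField K] [IsUltrametricDist K]

/-- The ring of integers `𝒪 = {a : K | ‖a‖ ≤ 1}` of `K`. -/
abbrev RingOfIntegers : Subring K := (NormedField.valuation (K := K)).integer

variable (E : Type*) [AddCommGroup E] [Module K E] [TopologicalSpace E]

/-- `E` is a locally convex `K`-vector space: a topological `K`-vector space in which the open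
`𝒪`-submodules form a basis of neighbourhoods of zero. (In a topological vector space every open
`𝒪`-submodule is absorbing, that is, a lattice.) -/
structure IsLocallyConvex : Prop where
  isTopologicalAddGroup : IsTopologicalAddGroup E
  continuousSMul : ContinuousSMul K E
  exists_open_lattice : ∀ U ∈ 𝓝 (0 : E),
    ∃ Λ : Submodule (RingOfIntegers K) E, IsOpen (Λ : Set E) ∧ (Λ : Set E) ⊆ U

variable {E} in
/-- An `𝒪`-submodule `A` of `E` is compactoid if for every open lattice `Λ` of `E` there are
finitely many `v₁, …, v_m` in `E` with `A ⊆ Λ + 𝒪 v₁ + ⋯ + 𝒪 v_m`. -/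
def IsCompactoid (A : Submodule (RingOfIntegers K) E) : Prop :=
  ∀ Λ : Submodule (RingOfIntegers K) E, IsOpen (Λ : Set E) →
    ∃ S : Finset E, A ≤ Λ ⊔ Submodule.span (RingOfIntegers K) (S : Set E)

/-- The space `E'_c`: the continuous dual of `E` with the c-topology, i.e. the topology of uniform
convergence on the compactoid `𝒪`-submodules of `E`. -/
abbrev CDual : Type _ :=
  UniformConvergenceCLM (RingHom.id K) (E := E) K
    {B : Set E | ∃ A : Submodule (RingOfIntegers K) E, IsCompactoid K A ∧ (A : Set E) = B}

end LocallyConvex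

/-! ### The higher topologies on `R{{t}}` and `R((t))` -/

section HigherTopology

variable (K : Type u) [NontriviallyNormedField K] [IsUltrametricDist K]

/-- Here `R` carries a norm, the balls around `0` of which are the fractional ideals
`𝔭_R ^ c`, and a further topology `τ`. The basic neighbourhoods of zero of `R{{t}}` are the sets
`∑ M i * t ^ i`, where the `M i` are `τ`-open `𝒪`-submodules of `R` such that
some ball is contained in every `M i`, and every ball is contained in `M i` for all large `i`. -/
@[reducible] def curlyFilterBasis {R : Type u} [NormedCommRing R] [NormedAlgebra K R]
    (τ : TopologicalSpace R) : AddGroupFilterBasis (Curly R) :=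
  addGroupFilterBasisOfComm
    {N : Set (Curly R) | ∃ M : ℤ → Submodule (RingOfIntegers K) R,
      (∀ i, IsOpen[τ] (M i : Set R)) ∧
      (∃ ρ : ℝ, 0 < ρ ∧ ∀ i, Metric.closedBall (0 : R) ρ ⊆ M i) ∧
      (∀ ρ : ℝ, ∃ i₀ : ℤ, ∀ i, i₀ ≤ i → Metric.closedBall (0 : R) ρ ⊆ M i) ∧
      N = {x | ∀ i, x.coeff i ∈ M i}}
    ⟨_, fun _ => ⊤, fun _ => @isOpen_univ R τ, ⟨1, one_pos, fun _ _ _ => trivial⟩,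
      fun _ => ⟨0, fun _ _ _ _ => trivial⟩, rfl⟩
    (by
      rintro _ _ ⟨M, hM, ⟨ρ, hρ, hMρ⟩, hM', rfl⟩ ⟨M₂, hM₂, ⟨ρ₂, hρ₂, hMρ₂⟩, hM₂', rfl⟩
      refine ⟨_, ⟨fun i => M i ⊓ M₂ i, fun i => IsOpen.inter (hM i) (hM₂ i),
        ⟨min ρ ρ₂, lt_min hρ hρ₂, fun i => Set.subset_inter
          ((Metric.closedBall_subset_closedBall (min_le_left _ _)).trans (hMρ i))
          ((Metric.closedBall_subset_closedBall (min_le_right _ _)).trans (hMρ₂ i))⟩,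
        fun σ => ?_, rfl⟩, fun x hx => ⟨fun i => (hx i).1, fun i => (hx i).2⟩⟩
      obtain ⟨i₁, h₁⟩ := hM' σ
      obtain ⟨i₂, h₂⟩ := hM₂' σ
      exact ⟨max i₁ i₂, fun i hi => Set.subset_inter (h₁ i ((le_max_left _ _).trans hi))
        (h₂ i ((le_max_right _ _).trans hi))⟩)
    (by
      rintro _ ⟨M, -, -, -, rfl⟩ i
      exact (M i).zero_mem)
    (by
      rintro _ ⟨M, h₁, h₂, h₃, rfl⟩
      refine ⟨_, ⟨M, h₁, h₂, h₃, rfl⟩, ?_⟩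
      rintro _ ⟨x, hx, y, hy, rfl⟩ i
      exact (M i).add_mem (hx i) (hy i))
    (by
      rintro _ ⟨M, h₁, h₂, h₃, rfl⟩
      exact ⟨_, ⟨M, h₁, h₂, h₃, rfl⟩, fun x hx i => (M i).neg_mem (hx i)⟩)

/-- The basic neighbourhoods of zero of `R((t))` are the sets `∑ M i * t ^ i`, where the `M i` are
open `𝒪`-submodules of `R` with `M i = R` for all large `i`. -/
@[reducible] def laurentFilterBasis (R : Type u) [CommRing R] [Algebra K R] [TopologicalSpace R] :
    AddGroupFilterBasis (LaurentSeries R) :=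
  addGroupFilterBasisOfComm
    {N : Set (LaurentSeries R) | ∃ M : ℤ → Submodule (RingOfIntegers K) R,
      (∀ i, IsOpen (M i : Set R)) ∧
      (∃ i₀ : ℤ, ∀ i, i₀ ≤ i → M i = ⊤) ∧
      N = {x | ∀ i, x.coeff i ∈ M i}}
    ⟨_, fun _ => ⊤, fun _ => isOpen_univ, ⟨0, fun _ _ => rfl⟩, rfl⟩
    (by
      rintro _ _ ⟨M, hM, ⟨i₁, h₁⟩, rfl⟩ ⟨M₂, hM₂, ⟨i₂, h₂⟩, rfl⟩
      refine ⟨_, ⟨fun i => M i ⊓ M₂ i, fun i => (hM i).inter (hM₂ i),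
        ⟨max i₁ i₂, fun i hi => ?_⟩, rfl⟩, fun x hx => ⟨fun i => (hx i).1, fun i => (hx i).2⟩⟩
      simp only [h₁ i ((le_max_left _ _).trans hi), h₂ i ((le_max_right _ _).trans hi),
        inf_top_eq])
    (by
      rintro _ ⟨M, -, -, rfl⟩ i
      exact (M i).zero_mem)
    (by
      rintro _ ⟨M, h₁, h₂, rfl⟩
      refine ⟨_, ⟨M, h₁, h₂, rfl⟩, ?_⟩
      rintro _ ⟨x, hx, y, hy, rfl⟩ i
      exact (M i).add_mem (hx i) (hy i))
    (by
      rintro _ ⟨M, h₁, h₂, rfl⟩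
      exact ⟨_, ⟨M, h₁, h₂, rfl⟩, fun x hx i => (M i).neg_mem (hx i)⟩)

end HigherTopology

/-! ### The fields `K{{t_1}}⋯{{t_r}}((t_{r+1}))⋯((t_{r+s}))` -/

section Tower

variable (K : Type u) [NontriviallyNormedField K] [IsUltrametricDist K]

/-- A bundle of the data needed to iterate `R ↦ R{{t}}`: the ring with its norm, the higher
topology (in general different from the norm topology), and the `(0, …, 0)`-coefficient. -/
structure NormedLevel where
  carrier : Type u
  [normedCommRing : NormedCommRing carrier]
  [normedAlgebra : NormedAlgebra K carrier]
  [isUltrametricDist : IsUltrametricDist carrier]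
  [completeSpace : CompleteSpace carrier]
  higherTopology : TopologicalSpace carrier
  coeffZero : carrier →ₗ[K] K

attribute [instance] NormedLevel.normedCommRing NormedLevel.normedAlgebra
  NormedLevel.isUltrametricDist NormedLevel.completeSpace

/-- A bundle of the data needed to iterate `R ↦ R((t))`: the ring with its higher topology, and the
`(0, …, 0)`-coefficient. -/
structure Level where
  carrier : Type u
  [commRing : CommRing carrier]
  [algebra : Algebra K carrier]
  [higherTopology : TopologicalSpace carrier]
  coeffZero : carrier →ₗ[K] K

attribute [instance] Level.commRing Level.algebra Level.higherTopology

instance : CoeSort (Level K) (Type u) := ⟨Level.carrier⟩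

variable {K}

/-- From `R` to `R{{t}}`. -/
def NormedLevel.curly (R : NormedLevel K) : NormedLevel K where
  carrier := Curly R.carrier
  higherTopology := (curlyFilterBasis K R.higherTopology).topology
  coeffZero := R.coeffZero ∘ₗ Curly.coeffHom K 0

/-- Forget the norm and keep the higher topology. -/
def NormedLevel.toLevel (R : NormedLevel K) : Level K where
  carrier := R.carrier
  higherTopology := R.higherTopology
  coeffZero := R.coeffZero

/-- From `R` to `R((t))`. -/
def Level.laurent (R : Level K) : Level K where
  carrier := LaurentSeries R
  algebra := HahnSeries.instAlgebra
  higherTopology := (laurentFilterBasis K R).topology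
  coeffZero :=
    { toFun := fun x => R.coeffZero (x.coeff 0)
      map_add' := fun x y => map_add R.coeffZero (x.coeff 0) (y.coeff 0)
      map_smul' := fun c x => map_smul R.coeffZero c (x.coeff 0) }

variable (K) [CompleteSpace K]

/-- `K{{t_1}}⋯{{t_r}}`, starting from `K` with its usual topology for `r = 0`. -/
def curlyTower : ℕ → NormedLevel K
  | 0 => { carrier := K, higherTopology := inferInstance, coeffZero := LinearMap.id }
  | r + 1 => (curlyTower r).curly

/-- `K{{t_1}}⋯{{t_r}}((t_{r+1}))⋯((t_{r+s}))` with its higher topology, and with the linear form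
`coeffZero`, which sends a series to its `(0, …, 0)`-coefficient. -/
def standardField (r : ℕ) : ℕ → Level K
  | 0 => (curlyTower K r).toLevel
  | s + 1 => (standardField r s).laurent

end Tower

end HigherLocalField

end

/-!
The field `F` is treated as a space of families `x : I → K`, where `I = ℤ × ⋯ × ℤ`, in the style of
Köthe's sequence spaces. For a set `V` of weights `I → ℝ≥0`, let the polar of `V` consist of the
weights `u` such that `u α * w (-α) → 0` along the cofinite filter for every `w ∈ V`. There is a set
`V` equal to its own polar such that

* a family `x` belongs to `F` if and only if `|x| ∈ V`;
* the higher topology is defined by the seminorms `sup_α w (-α) * |x α|`, for `w ∈ V`;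
* the form `x ↦ x(0, …, 0)` sends `x * y` to the unconditionally convergent sum `∑ x α * y (-α)`.

This is `IsKotheSpace`, together with the formula for the pairing. For `K` it holds with `I` a
point. It passes from `R` to `R{{t}}` and to `R((t))` (`IsKotheSpace.curly`,
`IsKotheSpace.laurent`): the conditions on the lattices `M i` which define the higher topology are
the reflections of the conditions on the coefficients of a series. Equality of `V` with its polar is
inherited (`polar_curlyWeights`, `polar_laurentWeights`), since a weight which violates the growth
conditions at infinity can be paired with a weight supported on an infinite set of bad points.

Every such space is self-dual (`IsKotheSpace.exists_equiv_cdual`). A continuous form `f` is bounded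
by a seminorm, so that the family `f (e_{-α})` lies in `F`, and `f` is the pairing with it because
`y = ∑ y α * e_α`; this gives bijectivity. For the topologies, the boxes `{x | |x α| ≤ v α}` with
`v ∈ V` are cofinal among the compactoids: a box is compactoid because, modulo a basic lattice, only
finitely many coefficients matter (`IsKotheSpace.isCompactoid_box`). Conversely, for a compactoid
`A` the weight `v α = sup_{x ∈ A} |x α|` lies in the polar of `V`, which is `V`
(`IsKotheSpace.exists_bound_of_isCompactoid`). The polar of a box with respect to the pairing is,
up to a bounded factor, the basic lattice of the same weight.
-/

namespace HigherLocalField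

open scoped NNReal

/-! ### Self-polar sets of weights -/

section Polar

variable {I : Type*} [InvolutiveNeg I]

/-- The polar of a set `V` of weights on `I`: the weights `u` whose product with the reflection
`α ↦ w (-α)` of any `w ∈ V` tends to zero along the cofinite filter. -/
def polar (V : Set (I → ℝ≥0)) : Set (I → ℝ≥0) :=
  {u | ∀ w ∈ V, ∀ ε : ℝ≥0, 0 < ε → {α | ε ≤ u α * w (-α)}.Finite}

variable {V : Set (I → ℝ≥0)}

theorem polar_mono {u u' : I → ℝ≥0} (hu' : u' ∈ polar V) (h : ∀ α, u α ≤ u' α) : u ∈ polar V :=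
  fun w hw ε hε => (hu' w hw ε hε).subset fun α hα =>
    le_trans (α := ℝ≥0) hα (mul_le_mul_left (h α) _)

theorem sup_mem_polar {u u' : I → ℝ≥0} (hu : u ∈ polar V) (hu' : u' ∈ polar V) :
    u ⊔ u' ∈ polar V := by
  intro w hw ε hε
  refine ((hu w hw ε hε).union (hu' w hw ε hε)).subset fun α hα => ?_
  rcases le_total (u α) (u' α) with h | h
  · right
    simpa [h] using hα
  · left
    simpa [h] using hα

theorem mul_mem_polar {u : I → ℝ≥0} (c : ℝ≥0) (hu : u ∈ polar V) :
    (fun α => c * u α) ∈ polar V := by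
  intro w hw ε hε
  rcases eq_or_ne c 0 with rfl | hc
  · simp [hε.not_ge]
  refine (hu w hw (ε / c) (by positivity)).subset fun α hα => ?_
  rw [Set.mem_ofPred_eq] at hα ⊢
  rw [div_le_iff₀' (by positivity), ← mul_assoc]
  exact hα

theorem mem_polar_of_finite {u : I → ℝ≥0} (hu : {α | u α ≠ 0}.Finite) : u ∈ polar V := by
  refine fun w _ ε hε => hu.subset fun α hα h => ?_
  rw [Set.mem_ofPred_eq, h, zero_mul] at hα
  exact hα.not_gt hε

theorem exists_bound_of_mem_polar {u w : I → ℝ≥0} (hu : u ∈ polar V) (hw : w ∈ V) :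
    ∃ C : ℝ≥0, 0 < C ∧ ∀ α, u α * w (-α) ≤ C := by
  have hfin := hu w hw 1 one_pos
  refine ⟨1 ⊔ hfin.toFinset.sup fun α => u α * w (-α), by simp, fun α => ?_⟩
  by_cases h : 1 ≤ u α * w (-α)
  · exact le_sup_of_le_right
      (Finset.le_sup (f := fun α => u α * w (-α)) (hfin.mem_toFinset.2 h))
  · exact le_sup_of_le_left (not_le.1 h).le

end Polar

/-! ### Köthe spaces -/

/-- Up to a fixed factor `C`, every `r ≥ 0` is the norm of an element of `K`. -/
theorem exists_nnnorm_between (K : Type*) [NontriviallyNormedField K] :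
    ∃ C : ℝ≥0, 0 < C ∧ ∀ r : ℝ≥0, ∃ b : K, r ≤ ‖b‖₊ ∧ ‖b‖₊ ≤ C * r := by
  obtain ⟨a, ha⟩ := NormedField.exists_one_lt_nnnorm K
  refine ⟨‖a‖₊, one_pos.trans ha, fun r => ?_⟩
  rcases eq_or_ne r 0 with rfl | hr
  · exact ⟨0, by simp⟩
  obtain ⟨n, hn, hn'⟩ := exists_mem_Ico_zpow (pos_iff_ne_zero.2 hr) ha
  refine ⟨a ^ (n + 1), ?_, ?_⟩
  · rw [nnnorm_zpow]
    exact hn'.le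
  · rw [nnnorm_zpow, zpow_add_one₀ (one_pos.trans ha).ne', mul_comm]
    gcongr

section Kothe

variable {K : Type*} [NontriviallyNormedField K] [IsUltrametricDist K]
  {I : Type*} {E : Type*} [AddCommGroup E] [Module K E]

/-- The `𝒪`-submodule of the `x` all of whose coefficients satisfy `k α * ‖x α‖ ≤ m α`. -/
def box (c : E →ₗ[K] I → K) (k m : I → ℝ≥0) : Submodule (RingOfIntegers K) E where
  carrier := {x | ∀ α, k α * ‖c x α‖₊ ≤ m α}
  zero_mem' := fun α => by simp
  add_mem' := fun {x y} hx hy α => by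
    have h : ‖c (x + y) α‖₊ ≤ max ‖c x α‖₊ ‖c y α‖₊ := by
      rw [map_add]
      exact IsUltrametricDist.nnnorm_add_le_max _ _
    refine (mul_le_mul_right h _).trans ?_
    rcases max_choice ‖c x α‖₊ ‖c y α‖₊ with h | h
    · rw [h]
      exact hx α
    · rw [h]
      exact hy α
  smul_mem' := fun a x hx α => by
    have ha : ‖(a : K)‖₊ ≤ 1 := a.2
    have : c (a • x) = (a : K) • c x := map_smul c (a : K) x
    rw [this, Pi.smul_apply, smul_eq_mul, nnnorm_mul]
    exact (mul_le_mul_right (mul_le_of_le_one_left' ha) _).trans (hx α)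

variable [InvolutiveNeg I]

/-- The basic lattice `{x | ∀ α, w (-α) * ‖x α‖ ≤ 1}` attached to a weight `w`. -/
def weightLattice (c : E →ₗ[K] I → K) (w : I → ℝ≥0) : Submodule (RingOfIntegers K) E :=
  box c (fun α => w (-α)) 1

/-- `E`, with the topology `τ` and the coefficient map `c`, is the space of all families
`x : I → K` with `|x| ∈ V`, where `V` is a set of weights equal to its own polar, and the
topology is the one defined by the seminorms `sup_α w (-α) * |x α|` for `w ∈ V`. -/
structure IsKotheSpace (τ : TopologicalSpace E) (V : Set (I → ℝ≥0)) (c : E →ₗ[K] I → K) :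
    Prop where
  polar_eq : polar V = V
  injective : Function.Injective c
  exists_iff : ∀ f : I → K, (∃ x, c x = f) ↔ (fun α => ‖f α‖₊) ∈ V
  isTopologicalAddGroup : IsTopologicalAddGroup E
  hasBasis : (𝓝 (0 : E)).HasBasis (fun w => w ∈ V) fun w => (weightLattice c w : Set E)

namespace IsKotheSpace

variable {τ : TopologicalSpace E} {V : Set (I → ℝ≥0)} {c : E →ₗ[K] I → K}

theorem mem_of_le (h : IsKotheSpace τ V c) {u u' : I → ℝ≥0} (hu' : u' ∈ V)
    (hle : ∀ α, u α ≤ u' α) : u ∈ V := by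
  rw [← h.polar_eq] at hu' ⊢
  exact polar_mono hu' hle

theorem sup_mem (h : IsKotheSpace τ V c) {u u' : I → ℝ≥0} (hu : u ∈ V) (hu' : u' ∈ V) :
    u ⊔ u' ∈ V := by
  rw [← h.polar_eq] at hu hu' ⊢
  exact sup_mem_polar hu hu'

theorem mul_mem (h : IsKotheSpace τ V c) {u : I → ℝ≥0} (a : ℝ≥0) (hu : u ∈ V) :
    (fun α => a * u α) ∈ V := by
  rw [← h.polar_eq] at hu ⊢
  exact mul_mem_polar a hu

theorem mem_of_finite (h : IsKotheSpace τ V c) {u : I → ℝ≥0} (hu : {α | u α ≠ 0}.Finite) :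
    u ∈ V := by
  rw [← h.polar_eq]
  exact mem_polar_of_finite hu

theorem finite_le (h : IsKotheSpace τ V c) {u w : I → ℝ≥0} (hu : u ∈ V) (hw : w ∈ V)
    {ε : ℝ≥0} (hε : 0 < ε) : {α | ε ≤ u α * w (-α)}.Finite :=
  (h.polar_eq.symm ▸ hu : u ∈ polar V) w hw ε hε

theorem exists_bound (h : IsKotheSpace τ V c) {u w : I → ℝ≥0} (hu : u ∈ V) (hw : w ∈ V) :
    ∃ C : ℝ≥0, 0 < C ∧ ∀ α, u α * w (-α) ≤ C :=
  exists_bound_of_mem_polar (h.polar_eq.symm ▸ hu) hw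

theorem nnnorm_mem (h : IsKotheSpace τ V c) (x : E) : (fun α => ‖c x α‖₊) ∈ V :=
  (h.exists_iff _).1 ⟨x, rfl⟩

theorem exists_of_le (h : IsKotheSpace τ V c) {f : I → K} {u : I → ℝ≥0} (hu : u ∈ V)
    (hf : ∀ α, ‖f α‖₊ ≤ u α) : ∃ x, c x = f :=
  (h.exists_iff f).2 (h.mem_of_le hu hf)

theorem isOpen_weightLattice (h : IsKotheSpace τ V c) {w : I → ℝ≥0} (hw : w ∈ V) :
    IsOpen (weightLattice c w : Set E) := by
  have := h.isTopologicalAddGroup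
  exact (weightLattice c w).toAddSubgroup.isOpen_of_mem_nhds (g := 0) (h.hasBasis.mem_of_mem hw)

theorem exists_weightLattice_le (h : IsKotheSpace τ V c)
    {Λ : Submodule (RingOfIntegers K) E} (hΛ : IsOpen (Λ : Set E)) :
    ∃ w ∈ V, weightLattice c w ≤ Λ :=
  h.hasBasis.mem_iff.1 (hΛ.mem_nhds Λ.zero_mem)

theorem isLocallyConvex (h : IsKotheSpace τ V c) : IsLocallyConvex K E := by
  have := h.isTopologicalAddGroup
  refine ⟨this, ContinuousSMul.of_nhds_zero ?_ (fun x => ?_) fun a => ?_, fun U hU => ?_⟩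
  · refine h.hasBasis.tendsto_right_iff.2 fun w hw => ?_
    filter_upwards [prod_mem_prod (Metric.closedBall_mem_nhds (0 : K) one_pos)
      (h.hasBasis.mem_of_mem hw)]
    rintro ⟨a, x⟩ ⟨ha, hx⟩
    rw [mem_closedBall_zero_iff] at ha
    exact (weightLattice c w).smul_mem ⟨a, ha⟩ hx
  · refine h.hasBasis.tendsto_right_iff.2 fun w hw => ?_
    obtain ⟨C, hC, hb⟩ := h.exists_bound (h.nnnorm_mem x) hw
    filter_upwards [Metric.closedBall_mem_nhds (0 : K) (ε := (C⁻¹ : ℝ≥0)) (by positivity)]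
      with a ha
    rw [mem_closedBall_zero_iff, ← coe_nnnorm, NNReal.coe_le_coe] at ha
    intro α
    rw [map_smul, Pi.smul_apply, smul_eq_mul, nnnorm_mul, mul_left_comm, mul_comm (w _)]
    calc ‖a‖₊ * (‖c x α‖₊ * w (-α)) ≤ C⁻¹ * C := mul_le_mul' ha (hb α)
      _ = 1 := inv_mul_cancel₀ hC.ne'
  · refine h.hasBasis.tendsto_right_iff.2 fun w hw => ?_
    filter_upwards [h.hasBasis.mem_of_mem (h.mul_mem ‖a‖₊ hw)] with x hx α
    rw [map_smul, Pi.smul_apply, smul_eq_mul, nnnorm_mul, ← mul_assoc, mul_comm (w _)]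
    exact hx α
  · obtain ⟨w, hw, hwU⟩ := h.hasBasis.mem_iff.1 hU
    exact ⟨_, h.isOpen_weightLattice hw, hwU⟩

open Classical in
theorem exists_single (h : IsKotheSpace τ V c) (α : I) : ∃ x, c x = Pi.single α 1 :=
  (h.exists_iff _).2 <| h.mem_of_finite <| (Set.finite_singleton α).subset fun β hβ => by
    by_contra hne
    exact hβ (by simp [Pi.single_eq_of_ne (M := fun _ => K) hne])

open Classical in
/-- The element `e_α` of `E` whose only nonzero coefficient is a `1` in position `α`. -/
noncomputable def single (h : IsKotheSpace τ V c) (α : I) : E := (h.exists_single α).choose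

open Classical in
theorem coeff_single (h : IsKotheSpace τ V c) (α : I) : c (h.single α) = Pi.single α 1 :=
  (h.exists_single α).choose_spec

theorem coeff_smul_single_self (h : IsKotheSpace τ V c) (a : K) (α : I) :
    c (a • h.single α) α = a := by
  classical
  rw [map_smul, Pi.smul_apply, coeff_single, Pi.single_eq_same, smul_eq_mul, mul_one]

theorem coeff_smul_single_of_ne (h : IsKotheSpace τ V c) (a : K) {α β : I} (hne : β ≠ α) :
    c (a • h.single α) β = 0 := by
  classical
  rw [map_smul, Pi.smul_apply, coeff_single, Pi.single_eq_of_ne hne, smul_zero]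

theorem smul_single_mem_box (h : IsKotheSpace τ V c) {a : K} {α : I} {k m : I → ℝ≥0}
    (hα : k α * ‖a‖₊ ≤ m α) : a • h.single α ∈ box c k m := by
  intro β
  rcases eq_or_ne β α with rfl | hne
  · rwa [coeff_smul_single_self]
  · simp [coeff_smul_single_of_ne h a hne]

/-- Removing from `x` its finitely many large terms leaves an element of a given lattice. -/
theorem sub_sum_single_mem (h : IsKotheSpace τ V c) {x : E} {w : I → ℝ≥0} {s : Finset I}
    (hs : ∀ α, 1 < w (-α) * ‖c x α‖₊ → α ∈ s) :
    x - ∑ α ∈ s, c x α • h.single α ∈ weightLattice c w := by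
  classical
  intro β
  have hsum : c (∑ α ∈ s, c x α • h.single α) β = if β ∈ s then c x β else 0 := by
    rw [map_sum, Finset.sum_apply]
    split_ifs with hβ
    · rw [Finset.sum_eq_single_of_mem β hβ fun α _ hne => h.coeff_smul_single_of_ne _ hne.symm,
        coeff_smul_single_self]
    · exact Finset.sum_eq_zero fun α hα =>
        h.coeff_smul_single_of_ne _ fun e => hβ (e ▸ hα)
  rw [map_sub, Pi.sub_apply, hsum]
  split_ifs with hβ
  · simp
  · rw [sub_zero]
    exact not_lt.1 fun hlt => hβ (hs β hlt)

theorem hasSum_single (h : IsKotheSpace τ V c) (x : E) :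
    HasSum (fun α => c x α • h.single α) x := by
  have := h.isTopologicalAddGroup
  have key : Tendsto (fun s : Finset I => x - ∑ α ∈ s, c x α • h.single α) atTop (𝓝 0) := by
    refine h.hasBasis.tendsto_right_iff.2 fun w hw => ?_
    have hfin := h.finite_le (h.nnnorm_mem x) hw one_pos
    filter_upwards [eventually_ge_atTop hfin.toFinset] with s hs
    refine h.sub_sum_single_mem fun α hα => hs (hfin.mem_toFinset.2 ?_)
    rw [Set.mem_ofPred_eq, mul_comm]
    exact hα.le
  simpa [HasSum] using tendsto_const_nhds (x := x) |>.sub key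

/-! ### Compactoids -/

/-- Every box `{x | ∀ α, ‖x α‖ ≤ v α}` with `v ∈ V` is compactoid: modulo a basic lattice only
finitely many coefficients matter, and each of these ranges over a bounded set. -/
theorem isCompactoid_box (h : IsKotheSpace τ V c) {v : I → ℝ≥0} (hv : v ∈ V) :
    IsCompactoid K (box c 1 v) := by
  classical
  intro Λ hΛ
  obtain ⟨w, hw, hwΛ⟩ := h.exists_weightLattice_le hΛ
  obtain ⟨C, -, hC⟩ := exists_nnnorm_between K
  -- A coefficient `c x α` with `‖c x α‖ ≤ v α` is an integral multiple of `b α`.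
  choose b hb _ using fun α => hC (v α)
  have hfin := h.finite_le hv hw one_pos
  refine ⟨hfin.toFinset.image fun α => b α • h.single α, fun x hx => ?_⟩
  have hx' : ∀ α, ‖c x α‖₊ ≤ v α := fun α => by simpa using hx α
  rw [← sub_add_cancel x (∑ α ∈ hfin.toFinset, c x α • h.single α)]
  refine Submodule.add_mem_sup (hwΛ (h.sub_sum_single_mem fun α hα => ?_))
    (Submodule.sum_mem _ fun α hα => ?_)
  · rw [hfin.mem_toFinset, Set.mem_ofPred_eq, mul_comm]
    exact hα.le.trans (mul_le_mul_right (hx' α) _)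
  · have hle : ‖c x α‖₊ ≤ ‖b α‖₊ := (hx' α).trans (hb α)
    have hdiv : ‖c x α / b α‖₊ ≤ 1 := by
      rw [nnnorm_div]
      exact div_le_one_of_le₀ hle (by positivity)
    have hmul : c x α / b α * b α = c x α := by
      rcases eq_or_ne (b α) 0 with h0 | h0
      · have : c x α = 0 := by simpa [h0] using hle
        simp [this]
      · exact div_mul_cancel₀ _ h0
    have heq : c x α • h.single α =
        (⟨c x α / b α, hdiv⟩ : RingOfIntegers K) • (b α • h.single α) := by
      change _ = (c x α / b α) • (b α • h.single α)
      rw [smul_smul, hmul]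
    rw [heq]
    exact Submodule.smul_mem _ _ (Submodule.subset_span
      (Finset.mem_coe.2 (Finset.mem_image_of_mem _ hα)))

/-- The weighted coefficients of the elements of a compactoid are, up to `ε`, bounded by those of
finitely many elements. -/
theorem exists_le_of_isCompactoid (h : IsKotheSpace τ V c) {A : Submodule (RingOfIntegers K) E}
    (hA : IsCompactoid K A) {w : I → ℝ≥0} (hw : w ∈ V) {ε : ℝ≥0} (hε : 0 < ε) :
    ∃ u ∈ V, ∀ x ∈ A, ∀ α, w (-α) * ‖c x α‖₊ ≤ ε ⊔ w (-α) * u α := by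
  classical
  obtain ⟨S, hS⟩ := hA _ (h.isOpen_weightLattice (h.mul_mem ε⁻¹ hw))
  have hu : ∀ T : Finset E, (fun α => T.sup fun y => ‖c y α‖₊) ∈ V := by
    intro T
    induction T using Finset.induction_on with
    | empty => exact h.mem_of_finite (by simp)
    | insert y T _ ih =>
      simp only [Finset.sup_insert]
      exact h.sup_mem (h.nnnorm_mem y) ih
  refine ⟨_, hu S, fun x hx => ?_⟩
  suffices hle : weightLattice c (fun α => ε⁻¹ * w α) ⊔
      Submodule.span (RingOfIntegers K) (S : Set E) ≤
      box c (fun α => w (-α)) fun α => ε ⊔ w (-α) * S.sup fun y => ‖c y α‖₊ from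
    hle (hS hx)
  refine sup_le (fun y hy α => le_sup_of_le_left ?_)
    (Submodule.span_le.2 fun y hy α => le_sup_of_le_right ?_)
  · have := hy α
    rw [mul_assoc, inv_mul_le_iff₀ hε] at this
    simpa using this
  · exact mul_le_mul_right (Finset.le_sup (f := fun y => ‖c y α‖₊) hy) _

/-- Every compactoid is contained in a box `{x | ∀ α, ‖x α‖ ≤ v α}` with `v ∈ V`. -/
theorem exists_bound_of_isCompactoid (h : IsKotheSpace τ V c)
    {A : Submodule (RingOfIntegers K) E} (hA : IsCompactoid K A) :
    ∃ v ∈ V, ∀ x ∈ A, ∀ α, ‖c x α‖₊ ≤ v α := by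
  classical
  have hbdd : ∀ α, BddAbove (Set.range fun x : A => ‖c x α‖₊) := by
    intro α
    obtain ⟨u, -, hu⟩ := h.exists_le_of_isCompactoid hA (w := Pi.single (-α) 1)
      (h.mem_of_finite ((Set.finite_singleton (-α)).subset fun β hβ => by
        by_contra hne
        exact hβ (Pi.single_eq_of_ne hne _))) one_pos
    refine ⟨1 ⊔ u α, ?_⟩
    rintro _ ⟨x, rfl⟩
    simpa using hu x x.2 α
  refine ⟨fun α => ⨆ x : A, ‖c x α‖₊, ?_, fun x hx α => le_ciSup (hbdd α) ⟨x, hx⟩⟩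
  rw [← h.polar_eq]
  intro w hw ε hε
  -- With `ε / 2`, only the second term of the bound can reach `ε`.
  obtain ⟨u, hu, hle⟩ := h.exists_le_of_isCompactoid hA hw (half_pos hε)
  refine (h.finite_le hu hw hε).subset fun α hα => ?_
  have h1 : (⨆ x : A, ‖c x α‖₊) * w (-α) ≤ ε / 2 ⊔ w (-α) * u α :=
    NNReal.iSup_mul_le fun x => by
      rw [mul_comm]
      exact hle x x.2 α
  rcases le_sup_iff.1 (le_trans (α := ℝ≥0) hα h1) with h2 | h2
  · exact absurd h2 (NNReal.half_lt_self hε.ne').not_ge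
  · rw [Set.mem_ofPred_eq, mul_comm]
    exact h2

/-! ### The pairing -/

theorem norm_pairing_le {x y : E} {ε : ℝ≥0} (hle : ∀ α, ‖c x α‖₊ * ‖c y (-α)‖₊ ≤ ε) :
    ‖∑' α, c x α * c y (-α)‖ ≤ ε :=
  IsUltrametricDist.norm_tsum_le_of_forall_le_of_nonneg ε.2 fun α => by
    rw [norm_mul]
    exact hle α

variable [CompleteSpace K]

theorem summable_pairing (h : IsKotheSpace τ V c) (x y : E) :
    Summable fun α => c x α * c y (-α) := by
  refine NonarchimedeanAddGroup.summable_of_tendsto_cofinite_zero ?_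
  rw [Metric.tendsto_nhds]
  intro ε hε
  refine (h.finite_le (h.nnnorm_mem x) (h.nnnorm_mem y) (ε := ⟨ε, hε.le⟩) hε).subset fun α hα => ?_
  rw [Set.mem_compl_iff, Set.mem_ofPred_eq, dist_zero_right, not_lt, norm_mul] at hα
  exact hα

/-- The linear form `y ↦ ∑ x α * y (-α)` on `E`. -/
noncomputable def pairing (h : IsKotheSpace τ V c) (x : E) : E →ₗ[K] K where
  toFun y := ∑' α, c x α * c y (-α)
  map_add' y z := by
    rw [← (h.summable_pairing x y).tsum_add (h.summable_pairing x z)]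
    simp [mul_add]
  map_smul' a y := by
    rw [RingHom.id_apply, smul_eq_mul, ← (h.summable_pairing x y).tsum_mul_left]
    simp [mul_left_comm]

theorem continuous_pairing (h : IsKotheSpace τ V c) (x : E) : Continuous (h.pairing x) := by
  have := h.isTopologicalAddGroup
  refine continuous_of_continuousAt_zero (h.pairing x) ?_
  rw [ContinuousAt, map_zero, Metric.nhds_basis_closedBall.tendsto_right_iff]
  intro ε hε
  lift ε to ℝ≥0 using hε.le
  rw [NNReal.coe_pos] at hε
  filter_upwards [h.hasBasis.mem_of_mem (h.mul_mem ε⁻¹ (h.nnnorm_mem x))] with y hy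
  rw [mem_closedBall_zero_iff]
  refine norm_pairing_le fun α => ?_
  have := hy (-α)
  simp only [neg_neg] at this
  rw [mul_assoc, Pi.one_apply, inv_mul_le_iff₀ hε, mul_one] at this
  exact this

/-- The map `x ↦ (y ↦ ∑ x α * y (-α))` from `E` to its dual. -/
noncomputable def toDual (h : IsKotheSpace τ V c) : E →ₗ[K] CDual K E where
  toFun x := (⟨h.pairing x, h.continuous_pairing x⟩ : E →L[K] K)
  map_add' x y := by
    refine UniformConvergenceCLM.ext _ _ fun z => ?_
    change ∑' α, c (x + y) α * c z (-α) = ∑' α, c x α * c z (-α) + ∑' α, c y α * c z (-α)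
    rw [← (h.summable_pairing x z).tsum_add (h.summable_pairing y z)]
    simp [add_mul]
  map_smul' a x := by
    refine UniformConvergenceCLM.ext _ _ fun z => ?_
    change ∑' α, c (a • x) α * c z (-α) = a * ∑' α, c x α * c z (-α)
    rw [← (h.summable_pairing x z).tsum_mul_left]
    simp [mul_assoc]

theorem toDual_apply (h : IsKotheSpace τ V c) (x y : E) :
    h.toDual x y = ∑' α, c x α * c y (-α) := rfl

theorem toDual_smul_single (h : IsKotheSpace τ V c) (x : E) (a : K) (α : I) :
    h.toDual x (a • h.single (-α)) = c x α * a := by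
  rw [toDual_apply, tsum_eq_single α, coeff_smul_single_self]
  intro β hβ
  rw [coeff_smul_single_of_ne _ _ fun e => hβ (neg_injective e), mul_zero]

theorem injective_toDual (h : IsKotheSpace τ V c) : Function.Injective h.toDual := by
  refine fun x y hxy => h.injective (funext fun α => ?_)
  have := congrArg (fun f : CDual K E => f ((1 : K) • h.single (-α))) hxy
  simp only [toDual_smul_single, mul_one] at this
  exact this

/-- A continuous form `f` is bounded by some weight `w`, so the family `f (e_{-α})` is bounded by a
multiple of `w ∈ V`, and hence is the family of coefficients of an element of `E`. -/
theorem surjective_toDual (h : IsKotheSpace τ V c) : Function.Surjective h.toDual := by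
  intro f
  have hfc : Continuous f := ContinuousLinearMap.continuous (f : E →L[K] K)
  have hf0 : f ⁻¹' Metric.ball 0 1 ∈ 𝓝 (0 : E) :=
    hfc.continuousAt.preimage_mem_nhds (by rw [map_zero]; exact Metric.ball_mem_nhds _ one_pos)
  obtain ⟨w, hw, hwf⟩ := h.hasBasis.mem_iff.1 hf0
  obtain ⟨C, hC0, hC⟩ := exists_nnnorm_between K
  have hle : ∀ α, ‖f (h.single (-α))‖₊ ≤ C * w α := by
    intro α
    by_contra! hlt
    set s := ‖f (h.single (-α))‖₊ with hs
    have hs0 : 0 < s := lt_of_le_of_lt (by positivity) hlt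
    obtain ⟨b, hb, hb'⟩ := hC s⁻¹
    -- `b • e_{-α}` lies in the lattice on which `‖f‖ < 1`, although `‖b‖ * s ≥ 1`.
    have hmem : b • h.single (-α) ∈ weightLattice c w := by
      refine h.smul_single_mem_box ?_
      rw [neg_neg, Pi.one_apply]
      calc w α * ‖b‖₊ ≤ w α * (C * s⁻¹) := by gcongr
        _ = (C * w α) * s⁻¹ := by ring
        _ ≤ s * s⁻¹ := by gcongr
        _ = 1 := mul_inv_cancel₀ hs0.ne'
    have hlt1 : ‖b‖₊ * s < 1 := by
      have := hwf hmem
      rw [Set.mem_preimage, map_smul, mem_ball_zero_iff, norm_smul] at this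
      exact this
    have : 1 ≤ ‖b‖₊ * s := by
      calc 1 = s⁻¹ * s := (inv_mul_cancel₀ hs0.ne').symm
        _ ≤ ‖b‖₊ * s := by gcongr
    exact this.not_gt hlt1
  obtain ⟨x, hx⟩ := h.exists_of_le (f := fun α => f (h.single (-α))) (h.mul_mem C hw) hle
  refine ⟨x, UniformConvergenceCLM.ext _ _ fun y => ?_⟩
  have hsum := (h.hasSum_single y).mapL (f : E →L[K] K)
  rw [← (Equiv.neg I).hasSum_iff] at hsum
  rw [toDual_apply, ← show _ = f y from hsum.tsum_eq]
  refine tsum_congr fun α => ?_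
  change _ = f (c y (-α) • h.single (-α))
  rw [map_smul, hx, smul_eq_mul, mul_comm]

/-- On a compactoid the coefficients are bounded by a weight `v ∈ V`, so that `toDual x` is small
on it as soon as `x` is small for the seminorm of `v`. -/
theorem continuous_toDual (h : IsKotheSpace τ V c) : Continuous h.toDual := by
  have := h.isTopologicalAddGroup
  refine continuous_of_continuousAt_zero h.toDual ?_
  rw [ContinuousAt, map_zero, UniformConvergenceCLM.nhds_zero_eq]
  refine tendsto_iInf.2 fun B => tendsto_iInf.2 ?_
  rintro ⟨A, hA, rfl⟩
  refine tendsto_iInf.2 fun U => tendsto_iInf.2 fun hU => tendsto_principal.2 ?_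
  obtain ⟨ε, hε, hεU⟩ := Metric.nhds_basis_closedBall.mem_iff.1 hU
  lift ε to ℝ≥0 using hε.le
  rw [NNReal.coe_pos] at hε
  obtain ⟨v, hv, hAv⟩ := h.exists_bound_of_isCompactoid hA
  filter_upwards [h.hasBasis.mem_of_mem (h.mul_mem ε⁻¹ hv)] with x hx y hy
  refine hεU ?_
  rw [mem_closedBall_zero_iff]
  refine norm_pairing_le fun α => (mul_le_mul_right (hAv y hy (-α)) _).trans ?_
  have := hx α
  rw [mul_assoc, Pi.one_apply, inv_mul_le_iff₀ hε, mul_one, mul_comm] at this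
  exact this

/-- If `x` pairs into the unit ball with the compactoid box of a large multiple of `w`, then
testing on multiples of the `e_α` shows that `x` lies in the basic lattice of `w`. -/
theorem mem_of_toDual_mem_nhds (h : IsKotheSpace τ V c) {U : Set E} (hU : U ∈ 𝓝 0) :
    ∃ N ∈ 𝓝 (0 : CDual K E), ∀ x, h.toDual x ∈ N → x ∈ U := by
  obtain ⟨w, hw, hwU⟩ := h.hasBasis.mem_iff.1 hU
  obtain ⟨C, hC0, hC⟩ := exists_nnnorm_between K
  refine ⟨{f | Set.MapsTo f (box c 1 fun α => C * w α) (Metric.closedBall 0 1)}, ?_,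
    fun x hx => hwU fun α => ?_⟩
  · rw [UniformConvergenceCLM.nhds_zero_eq]
    exact mem_iInf_of_mem _ (mem_iInf_of_mem ⟨_, h.isCompactoid_box (h.mul_mem C hw), rfl⟩
      (mem_iInf_of_mem _ (mem_iInf_of_mem (Metric.closedBall_mem_nhds _ one_pos)
        (mem_principal_self _))))
  · obtain ⟨b, hb, hb'⟩ := hC (w (-α))
    have hmem : b • h.single (-α) ∈ box c 1 fun α => C * w α :=
      h.smul_single_mem_box (by simpa using hb')
    have h1 : ‖c x α‖₊ * ‖b‖₊ ≤ 1 := by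
      have := hx hmem
      rw [toDual_smul_single, mem_closedBall_zero_iff, norm_mul] at this
      exact this
    calc w (-α) * ‖c x α‖₊ ≤ ‖b‖₊ * ‖c x α‖₊ := by gcongr
      _ ≤ 1 := by rwa [mul_comm]

/-- A Köthe space with self-polar set of weights is its own c-dual. -/
theorem exists_equiv_cdual (h : IsKotheSpace τ V c) :
    ∃ γ : E ≃L[K] CDual K E, ∀ x y : E, γ x y = ∑' α, c x α * c y (-α) := by
  let e := LinearEquiv.ofBijective h.toDual ⟨h.injective_toDual, h.surjective_toDual⟩
  refine ⟨⟨e, h.continuous_toDual, ?_⟩, h.toDual_apply⟩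
  have := h.isTopologicalAddGroup
  refine continuous_of_continuousAt_zero e.symm fun U hU => ?_
  rw [map_zero] at hU
  rw [mem_map]
  obtain ⟨N, hN, hNU⟩ := h.mem_of_toDual_mem_nhds hU
  refine mem_of_superset hN fun f hf => hNU _ ?_
  rwa [show h.toDual (e.symm f) = f from e.apply_symm_apply f]

end IsKotheSpace

end Kothe

/-- Local convexity is invariant under isomorphism. -/
theorem IsLocallyConvex.congr {K : Type*} [NontriviallyNormedField K] [IsUltrametricDist K]
    {E E' : Type*} [AddCommGroup E] [Module K E] [TopologicalSpace E]
    [AddCommGroup E'] [Module K E'] [TopologicalSpace E'] (h : IsLocallyConvex K E)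
    (e : E ≃L[K] E') : IsLocallyConvex K E' := by
  have h1 := h.isTopologicalAddGroup
  have h2 := h.continuousSMul
  have hs : IsInducing e.symm := e.symm.toHomeomorph.isInducing
  refine ⟨hs.topologicalAddGroup e.symm, hs.continuousSMul continuous_id (map_smul e.symm _ _),
    fun U hU => ?_⟩
  obtain ⟨Λ, hΛ, hΛU⟩ := h.exists_open_lattice (e ⁻¹' U)
    (e.continuous.continuousAt.preimage_mem_nhds (by rwa [map_zero]))
  refine ⟨Λ.comap (e.symm.toLinearEquiv.toLinearMap.restrictScalars (RingOfIntegers K)),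
    hΛ.preimage e.symm.continuous, fun y hy => ?_⟩
  simpa using hΛU hy

/-! ### Weights on `ℤ × I` -/

theorem finite_of_slices {I : Type*} {P : ℤ × I → Prop} {a b : ℤ}
    (hab : ∀ i α, P (i, α) → i ∈ Set.Icc a b)
    (h : ∀ i, {α | P (i, α)}.Finite) : {p | P p}.Finite := by
  refine ((Set.finite_Icc a b).biUnion fun i _ => (h i).image (Prod.mk i)).subset ?_
  rintro ⟨i, α⟩ hp
  exact Set.mem_biUnion (hab i α hp) ⟨α, hp, rfl⟩

section Weights

variable {I : Type*} [InvolutiveNeg I] {V : Set (I → ℝ≥0)}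

/-- The weights `v` on `ℤ × I` with all slices in `V`, bounded, and tending to zero uniformly
on the slices as `i → -∞`. -/
def curlyWeights (V : Set (I → ℝ≥0)) : Set (ℤ × I → ℝ≥0) :=
  {v | (∀ i, (fun α => v (i, α)) ∈ V) ∧ (∃ C, ∀ i α, v (i, α) ≤ C) ∧
    ∀ ε : ℝ≥0, 0 < ε → ∃ N : ℤ, ∀ i < N, ∀ α, v (i, α) ≤ ε}

/-- The weights `v` on `ℤ × I` with all slices in `V`, and with zero slices for `i ≪ 0`. -/
def laurentWeights (V : Set (I → ℝ≥0)) : Set (ℤ × I → ℝ≥0) :=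
  {v | (∀ i, (fun α => v (i, α)) ∈ V) ∧ ∃ N : ℤ, ∀ i < N, ∀ α, v (i, α) = 0}

/-- The test used to bound an element `u` of a polar: `u` cannot be at least `ε / g` on an infinite
set `S` if the reflection of `g`, restricted to `S`, is among the weights. -/
theorem finite_of_mem_polar {u g : I → ℝ≥0} {S : Set I} (hu : u ∈ polar V)
    (hw : (fun α => S.indicator g (-α)) ∈ V) {ε : ℝ≥0} (hε : 0 < ε)
    (hle : ∀ α ∈ S, ε ≤ u α * g α) : S.Finite := by
  refine (hu _ hw ε hε).subset fun α hα => ?_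
  rw [Set.mem_ofPred_eq, neg_neg, Set.indicator_of_mem hα]
  exact hle α hα

theorem slice_indicator_mem (hV : polar V = V) {S : Set (ℤ × I)} (g : ℤ × I → ℝ≥0)
    (hS : ∀ i, {α | (i, α) ∈ S}.Finite) (j : ℤ) :
    (fun α => S.indicator g (-(j, α))) ∈ V := by
  rw [← hV]
  refine mem_polar_of_finite (((hS (-j)).preimage neg_injective.injOn).subset fun α hα => ?_)
  by_contra hne
  exact hα (Set.indicator_of_notMem (s := S) (a := -(j, α)) hne g)

open Classical in
theorem slice_mem_of_mem_polar (hV : polar V = V) {V' : Set (ℤ × I → ℝ≥0)}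
    (hV' : ∀ w ∈ V, ∀ j : ℤ, (fun p : ℤ × I => if p.1 = j then w p.2 else 0) ∈ V')
    {u : ℤ × I → ℝ≥0} (hu : u ∈ polar V') (i : ℤ) : (fun α => u (i, α)) ∈ V := by
  rw [← hV]
  intro w hw ε hε
  refine ((hu _ (hV' w hw (-i)) ε hε).preimage (Prod.mk_right_injective i).injOn).subset
    fun α hα => ?_
  simpa using hα

theorem ite_slice_mem (hV : polar V = V) {w : I → ℝ≥0} (hw : w ∈ V) (p : Prop) [Decidable p] :
    (fun α => if p then w α else 0) ∈ V := by
  split_ifs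
  · exact hw
  · rw [← hV]
    exact mem_polar_of_finite (by simp)

/-- If `u` is in the polar of `curlyWeights V`, its slices tend to zero uniformly at `-∞`: otherwise
pair `u` with the indicator function of a set which picks one large value in each of infinitely many
slices. -/
theorem exists_small_of_mem_polar_curlyWeights (hV : polar V = V) {u : ℤ × I → ℝ≥0}
    (hu : u ∈ polar (curlyWeights V)) {ε : ℝ≥0} (hε : 0 < ε) :
    ∃ N : ℤ, ∀ i < N, ∀ α, u (i, α) ≤ ε := by
  by_contra! hcon
  have hch : ∀ i : ℤ, ∃ A : Set I, A.Finite ∧ (∀ α ∈ A, ε < u (i, α)) ∧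
      ((∃ α, ε < u (i, α)) → A.Nonempty) := by
    intro i
    by_cases h : ∃ α, ε < u (i, α)
    · obtain ⟨α, hα⟩ := h
      exact ⟨{α}, Set.finite_singleton α, fun β hβ => hβ ▸ hα, fun _ => ⟨α, rfl⟩⟩
    · exact ⟨∅, Set.finite_empty, fun _ h => h.elim, fun h' => absurd h' h⟩
  choose A hAf hAε hA using hch
  have hS : {p : ℤ × I | p.1 < 0 ∧ p.2 ∈ A p.1}.Finite := by
    refine finite_of_mem_polar hu (g := 1)
      ⟨slice_indicator_mem hV _ fun i => ?_, ⟨1, fun i α => ?_⟩,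
      fun δ _ => ⟨0, fun i hi α => ?_⟩⟩ hε ?_
    · exact (hAf i).subset fun α hα => hα.2
    · exact Set.indicator_le_self' (f := 1) (fun _ _ => zero_le_one) _
    · refine (Set.indicator_of_notMem ?_ _).trans_le zero_le
      rintro ⟨h, -⟩
      simp only [Prod.neg_mk] at h
      omega
    · rintro ⟨i, α⟩ ⟨-, hα⟩
      simpa using (hAε i α hα).le
  obtain ⟨m, hm⟩ := (hS.image Prod.fst).bddBelow
  obtain ⟨i, hi, hα⟩ := hcon (min m 0)
  obtain ⟨β, hβ⟩ := hA i hα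
  have : m ≤ i := hm ⟨(i, β), ⟨hi.trans_le (min_le_right _ _), hβ⟩, rfl⟩
  exact (hi.trans_le (min_le_left _ _)).not_ge this

/-- If `u` is in the polar of `curlyWeights V`, it is bounded: otherwise pair `u` with `1 / u` on a
sequence of points along which `u` is unbounded. Such a sequence leaves every half-space
`i ≤ i₀`, as `u` is bounded there. -/
theorem exists_bound_of_mem_polar_curlyWeights (hV : polar V = V) {u : ℤ × I → ℝ≥0}
    (hu : u ∈ polar (curlyWeights V)) (hb : ∀ i, ∃ C, ∀ α, u (i, α) ≤ C) :
    ∃ C, ∀ i α, u (i, α) ≤ C := by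
  choose B hB using hb
  by_contra! hcon
  choose i α hiα using fun n : ℕ => hcon (n + 1)
  set p : ℕ → ℤ × I := fun n => (i n, α n)
  have hfin : ∀ C : ℝ≥0, {n : ℕ | u (p n) ≤ C}.Finite := by
    intro C
    refine (Set.finite_Iio ⌈C⌉₊).subset fun n hn => Nat.lt_ceil.2 ?_
    exact (lt_add_one _).trans ((hiα n).trans_le hn)
  have hS : (Set.range p).Finite := by
    refine finite_of_mem_polar hu (g := fun p => (u p)⁻¹)
      ⟨slice_indicator_mem hV _ fun j => ?_, ⟨1, fun j β => ?_⟩, fun δ hδ => ?_⟩ one_pos ?_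
    · refine ((hfin (B j)).image α).subset ?_
      rintro β ⟨n, hn⟩
      obtain ⟨rfl, rfl⟩ := Prod.mk.inj hn
      exact ⟨n, hB _ _, rfl⟩
    · refine Set.indicator_le' (g := fun _ => 1) ?_ (fun _ _ => zero_le_one) _
      rintro _ ⟨n, rfl⟩
      exact inv_le_one_of_one_le₀ (le_trans (by simp) (hiα n).le)
    · obtain ⟨M, hM⟩ := ((hfin δ⁻¹).image i).bddAbove
      refine ⟨-M, fun j hj β => ?_⟩
      dsimp only
      by_cases hmem : -(j, β) ∈ Set.range p
      · rw [Set.indicator_of_mem hmem]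
        obtain ⟨n, hn⟩ := hmem
        rw [← hn]
        refine inv_le_of_inv_le₀ hδ (le_of_not_ge fun hle => ?_)
        have h1 : i n ≤ M := hM ⟨n, hle, rfl⟩
        have h2 : i n = -j := congrArg Prod.fst hn
        omega
      · rw [Set.indicator_of_notMem hmem]
        exact zero_le
    · rintro _ ⟨n, rfl⟩
      exact (mul_inv_cancel₀ (lt_of_le_of_lt zero_le (hiα n)).ne').ge
  obtain ⟨C, hC⟩ := (hS.image u).bddAbove
  refine (Set.infinite_univ (α := ℕ)) ((hfin C).subset fun n _ => ?_)
  exact hC ⟨p n, ⟨n, rfl⟩, rfl⟩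

theorem polar_curlyWeights (hV : polar V = V) (hb : ∀ v ∈ V, ∃ C, ∀ α, v α ≤ C) :
    polar (curlyWeights V) = curlyWeights V := by
  classical
  refine Set.Subset.antisymm (fun u hu => ?_) ?_
  · have hslice : ∀ i, (fun α => u (i, α)) ∈ V := by
      refine slice_mem_of_mem_polar (V' := curlyWeights V) hV (fun w hw j => ?_) hu
      obtain ⟨C, hC⟩ := hb w hw
      refine ⟨fun i => ite_slice_mem hV hw (i = j), ⟨C, fun i α => ?_⟩,
        fun ε _ => ⟨j, fun i hi α => by simp [hi.ne]⟩⟩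
      dsimp only
      split_ifs
      exacts [hC α, zero_le]
    exact ⟨hslice, exists_bound_of_mem_polar_curlyWeights hV hu fun i => hb _ (hslice i),
      fun ε hε => exists_small_of_mem_polar_curlyWeights hV hu hε⟩
  · rintro v ⟨hv, ⟨C, hC⟩, hv0⟩ w ⟨hw, ⟨D, hD⟩, hw0⟩ ε hε
    obtain ⟨N, hN⟩ := hv0 (ε / 2 / (D + 1)) (by positivity)
    obtain ⟨N', hN'⟩ := hw0 (ε / 2 / (C + 1)) (by positivity)
    refine finite_of_slices (a := N) (b := -N') (fun i α h => ⟨?_, ?_⟩) fun i => ?_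
    · by_contra! hi
      have h1 : v (i, α) * w (-(i, α)) ≤ ε / 2 / (D + 1) * (D + 1) :=
        mul_le_mul' (hN i hi α) ((hD _ _).trans (by simp))
      rw [div_mul_cancel₀ _ (by positivity)] at h1
      exact (NNReal.half_lt_self hε.ne').not_ge (h.trans h1)
    · by_contra! hi
      have h1 : v (i, α) * w (-(i, α)) ≤ (C + 1) * (ε / 2 / (C + 1)) :=
        mul_le_mul' ((hC _ _).trans (by simp)) (hN' (-i) (by omega) (-α))
      rw [mul_div_cancel₀ _ (by positivity)] at h1
      exact (NNReal.half_lt_self hε.ne').not_ge (h.trans h1)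
    · exact (hV.symm ▸ hv i : _ ∈ polar V) _ (hw (-i)) ε hε

theorem polar_laurentWeights (hV : polar V = V) : polar (laurentWeights V) = laurentWeights V := by
  classical
  refine Set.Subset.antisymm (fun u hu => ?_) ?_
  · refine ⟨slice_mem_of_mem_polar (V' := laurentWeights V) hV (fun w hw j =>
      ⟨fun i => ite_slice_mem hV hw (i = j), j, fun i hi α => by simp [hi.ne]⟩) hu, ?_⟩
    -- Otherwise pair `u` with `1 / u` on a set which picks one nonzero value in each of
    -- infinitely many slices.
    by_contra! hcon
    have hch : ∀ i : ℤ, ∃ A : Set I, A.Finite ∧ (∀ α ∈ A, u (i, α) ≠ 0) ∧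
        ((∃ α, u (i, α) ≠ 0) → A.Nonempty) := by
      intro i
      by_cases h : ∃ α, u (i, α) ≠ 0
      · obtain ⟨α, hα⟩ := h
        exact ⟨{α}, Set.finite_singleton α, fun β hβ => hβ ▸ hα, fun _ => ⟨α, rfl⟩⟩
      · exact ⟨∅, Set.finite_empty, fun _ h => h.elim, fun h' => absurd h' h⟩
    choose A hAf hA0 hA using hch
    have hS : {p : ℤ × I | p.1 < 0 ∧ p.2 ∈ A p.1}.Finite := by
      refine finite_of_mem_polar hu (g := fun p => (u p)⁻¹)
        ⟨slice_indicator_mem hV _ fun i => ?_, ⟨0, fun i hi α => ?_⟩⟩ one_pos ?_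
      · exact (hAf i).subset fun α hα => hα.2
      · refine Set.indicator_of_notMem ?_ _
        rintro ⟨h, -⟩
        simp only [Prod.neg_mk] at h
        omega
      · rintro ⟨i, α⟩ ⟨-, hα⟩
        exact (mul_inv_cancel₀ (hA0 i α hα)).ge
    obtain ⟨m, hm⟩ := (hS.image Prod.fst).bddBelow
    obtain ⟨i, hi, hα⟩ := hcon (min m 0)
    obtain ⟨β, hβ⟩ := hA i hα
    have : m ≤ i := hm ⟨(i, β), ⟨hi.trans_le (min_le_right _ _), hβ⟩, rfl⟩
    exact (hi.trans_le (min_le_left _ _)).not_ge this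
  · rintro v ⟨hv, N, hN⟩ w ⟨hw, N', hN'⟩ ε hε
    refine finite_of_slices (a := N) (b := -N') (fun i α h => ⟨?_, ?_⟩) fun i => ?_
    · by_contra! hi
      rw [hN i hi, zero_mul] at h
      exact h.not_gt hε
    · by_contra! hi
      rw [Prod.neg_mk, hN' (-i) (by omega), mul_zero] at h
      exact h.not_gt hε
    · exact (hV.symm ▸ hv i : _ ∈ polar V) _ (hw (-i)) ε hε

end Weights

/-! ### The Köthe space `R{{t}}` -/

section CurlyStep

universe u

variable {K : Type u} [NontriviallyNormedField K] {I : Type*}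

/-- The norm of `E` is the supremum of the norms of the coefficients. -/
def IsSupNorm {E : Type*} [SeminormedAddCommGroup E] [Module K E] (c : E →ₗ[K] I → K) : Prop :=
  ∀ (x : E) (C : ℝ≥0), ‖x‖₊ ≤ C ↔ ∀ α, ‖c x α‖₊ ≤ C

theorem IsSupNorm.nnnorm_le {E : Type*} [SeminormedAddCommGroup E] [Module K E]
    {c : E →ₗ[K] I → K} (hn : IsSupNorm c) (x : E) (α : I) : ‖c x α‖₊ ≤ ‖x‖₊ :=
  (hn x _).1 le_rfl α

variable {R : Type u} [NormedCommRing R] [NormedAlgebra K R]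
  {τ : TopologicalSpace R} {V : Set (I → ℝ≥0)} {c : R →ₗ[K] I → K}

/-- The coefficients of a series with coefficients in `R`, indexed by `ℤ × I`. -/
def curlyCoeff [IsUltrametricDist R] [CompleteSpace R] (c : R →ₗ[K] I → K) :
    Curly R →ₗ[K] ℤ × I → K where
  toFun x p := c (x.coeff p.1) p.2
  map_add' x y := by
    ext p
    simp
  map_smul' a x := by
    ext p
    simp

theorem curlyCoeff_apply [IsUltrametricDist R] [CompleteSpace R] (x : Curly R) (i : ℤ) (α : I) :
    curlyCoeff c x (i, α) = c (x.coeff i) α := rfl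

theorem IsSupNorm.curly [IsUltrametricDist R] [CompleteSpace R] (hn : IsSupNorm c) :
    IsSupNorm (curlyCoeff c) := fun x C => by
  refine (Curly.norm_le C.2).trans ?_
  rw [Prod.forall]
  exact forall_congr' fun i => hn (x.coeff i) C

theorem Curly.hasSum_map [IsUltrametricDist R] [CompleteSpace R] {π : R →ₗ[K] K}
    (hπ : ∀ x, ‖π x‖ ≤ ‖x‖) (x y : Curly R) :
    HasSum (fun i => π (x.coeff i * y.coeff (-i))) (π ((x * y).coeff 0)) := by
  have hc : Continuous π :=
    AddMonoidHomClass.continuous_of_bound π 1 fun x => by simpa using hπ x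
  have h := (Curly.summable_mul x y 0).hasSum.map π hc
  simp only [Function.comp_def, zero_sub] at h
  simpa only [Curly.coeff_mul, zero_sub] using h

variable [IsUltrametricDist K] [InvolutiveNeg I]

theorem IsKotheSpace.exists_bound_weight (h : IsKotheSpace τ V c) (hn : IsSupNorm c)
    {v : I → ℝ≥0} (hv : v ∈ V) : ∃ C, ∀ α, v α ≤ C := by
  obtain ⟨C, -, hC⟩ := exists_nnnorm_between K
  choose b hb hb' using fun α => hC (v α)
  obtain ⟨x, hx⟩ := h.exists_of_le (f := b) (h.mul_mem C hv) hb'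
  refine ⟨‖x‖₊, fun α => (hb α).trans ?_⟩
  rw [← hx]
  exact hn.nnnorm_le x α

theorem closedBall_subset_weightLattice (hn : IsSupNorm c) {w : I → ℝ≥0} {a : ℝ≥0} {ρ : ℝ}
    (hw : ∀ α, w α ≤ a) (ha : a * ρ.toNNReal ≤ 1) :
    Metric.closedBall (0 : R) ρ ⊆ weightLattice c w := by
  intro x hx α
  rw [mem_closedBall_zero_iff] at hx
  have hx' : ‖x‖₊ ≤ ρ.toNNReal := by
    rw [← norm_toNNReal]
    exact Real.toNNReal_le_toNNReal hx
  exact (mul_le_mul' (hw _) ((hn.nnnorm_le x α).trans hx')).trans ha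

/-- A lattice which contains a basic lattice and a ball contains their sum, which is again a basic
lattice. -/
theorem IsKotheSpace.weightLattice_inf_le (h : IsKotheSpace τ V c) (hn : IsSupNorm c)
    {w : I → ℝ≥0} {r : ℝ≥0} (hr : 0 < r) {M : Submodule (RingOfIntegers K) R}
    (hwM : weightLattice c w ≤ M) (hrM : Metric.closedBall (0 : R) r ⊆ M) :
    weightLattice c (fun α => w α ⊓ r⁻¹) ≤ M := by
  classical
  intro x hx
  obtain ⟨y, hy⟩ := h.exists_of_le (f := fun α => if ‖c x α‖₊ ≤ r then c x α else 0)
    (h.nnnorm_mem x) fun α => by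
      split_ifs <;> simp
  rw [← sub_add_cancel x y]
  refine M.add_mem (hwM fun α => ?_) (hrM ?_)
  · rw [map_sub, Pi.sub_apply, hy]
    dsimp only
    split_ifs with hα
    · simp
    · rw [sub_zero]
      have hxα : (w (-α) ⊓ r⁻¹) * ‖c x α‖₊ ≤ 1 := hx α
      rcases le_total (w (-α)) r⁻¹ with hle | hle
      · rwa [inf_eq_left.2 hle] at hxα
      · rw [inf_eq_right.2 hle, inv_mul_le_iff₀ hr, mul_one] at hxα
        exact absurd hxα hα
  · rw [mem_closedBall_zero_iff, ← coe_nnnorm, NNReal.coe_le_coe, hn]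
    intro α
    rw [hy]
    dsimp only
    split_ifs with hα
    exacts [hα, by simp]

/-- Balls contained in the `M i` can be chosen so that their radii are bounded below and tend to
infinity. -/
theorem exists_radii {M : ℤ → Submodule (RingOfIntegers K) R}
    (h₁ : ∃ ρ : ℝ, 0 < ρ ∧ ∀ i, Metric.closedBall (0 : R) ρ ⊆ M i)
    (h₂ : ∀ ρ : ℝ, ∃ i₀ : ℤ, ∀ i, i₀ ≤ i → Metric.closedBall (0 : R) ρ ⊆ M i) :
    ∃ r : ℤ → ℝ≥0, (∃ ρ, 0 < ρ ∧ ∀ i, ρ ≤ r i) ∧ (∀ l, ∃ i₀ : ℤ, ∀ i, i₀ ≤ i → l ≤ r i) ∧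
      ∀ i, Metric.closedBall (0 : R) (r i) ⊆ M i := by
  classical
  obtain ⟨ρ, hρ, hM⟩ := h₁
  lift ρ to ℝ≥0 using hρ.le
  -- The largest integral radius that fits into `M i`, cut off at `i` because every radius fits if
  -- `M i` is everything.
  let n : ℤ → ℕ := fun i =>
    Nat.findGreatest (fun n => Metric.closedBall (0 : R) n ⊆ M i) i.toNat
  have hn : ∀ i, Metric.closedBall (0 : R) (n i) ⊆ M i := fun i =>
    Nat.findGreatest_spec (P := fun n : ℕ => Metric.closedBall (0 : R) n ⊆ M i)
      (Nat.zero_le _) (by simp)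
  refine ⟨fun i => ρ ⊔ n i, ⟨ρ, hρ, fun i => le_sup_left⟩, fun l => ?_, fun i => ?_⟩
  · obtain ⟨i₀, hi₀⟩ := h₂ (⌈l⌉₊ : ℕ)
    refine ⟨max i₀ ⌈l⌉₊, fun i hi => le_sup_of_le_right ((Nat.le_ceil l).trans ?_)⟩
    rw [Nat.cast_le]
    exact Nat.le_findGreatest (by omega) (hi₀ i ((le_max_left _ _).trans hi))
  · dsimp only
    rcases max_choice ρ (n i : ℝ≥0) with h | h
    · rw [h]
      exact hM i
    · rw [h]
      exact hn i

variable [IsUltrametricDist R] [CompleteSpace R]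

theorem IsKotheSpace.exists_curly_iff (h : IsKotheSpace τ V c) (hn : IsSupNorm c)
    (f : ℤ × I → K) :
    (∃ x, curlyCoeff c x = f) ↔ (fun p => ‖f p‖₊) ∈ curlyWeights V := by
  constructor
  · rintro ⟨x, rfl⟩
    refine ⟨fun i => h.nnnorm_mem (x.coeff i), ⟨‖x‖₊, fun i α => hn.curly.nnnorm_le x (i, α)⟩,
      fun ε hε => ?_⟩
    obtain ⟨N, hN⟩ := x.exists_small (ε := ε) hε
    exact ⟨N, fun i hi α => (hn.nnnorm_le (x.coeff i) α).trans (hN i hi).le⟩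
  · rintro ⟨hf, ⟨C, hC⟩, h0⟩
    choose x hx using fun i => (h.exists_iff fun α => f (i, α)).2 (hf i)
    refine ⟨Curly.mk x C (fun i => (hn _ C).2 fun α => ?_) ?_,
      funext fun p => congrFun (hx p.1) p.2⟩
    · rw [hx]
      exact hC i α
    · rw [Metric.tendsto_nhds]
      intro ε hε
      lift ε to ℝ≥0 using hε.le
      rw [gt_iff_lt, NNReal.coe_pos] at hε
      obtain ⟨N, hN⟩ := h0 (ε / 2) (half_pos hε)
      filter_upwards [Iio_mem_atBot N] with i hi
      have h1 : ‖x i‖₊ ≤ ε / 2 := (hn _ _).2 fun α => by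
        rw [hx]
        exact hN i hi α
      rw [dist_zero_right]
      exact h1.trans_lt (NNReal.half_lt_self hε.ne')

/-- If `R` is a Köthe space normed by the supremum of the coefficients, then so is `R{{t}}` with its
higher topology. -/
theorem IsKotheSpace.curly (h : IsKotheSpace τ V c) (hn : IsSupNorm c) :
    IsKotheSpace (curlyFilterBasis K τ).topology (curlyWeights V) (curlyCoeff c) where
  polar_eq := polar_curlyWeights h.polar_eq fun _ => h.exists_bound_weight hn
  injective x y hxy := Curly.ext fun i => h.injective (funext fun α => congrFun hxy (i, α))
  exists_iff := h.exists_curly_iff hn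
  isTopologicalAddGroup := (curlyFilterBasis K τ).isTopologicalAddGroup
  hasBasis := by
    refine (curlyFilterBasis K τ).nhds_zero_hasBasis.to_hasBasis ?_ ?_
    · rintro _ ⟨M, hM, h₁, h₂, rfl⟩
      obtain ⟨r, ⟨ρ, hρ, hρr⟩, hr, hrM⟩ := exists_radii h₁ h₂
      choose w hw hwM using fun i => h.exists_weightLattice_le (hM i)
      -- The weights `w i` are subject to no uniform bound; the balls contained in the `M i` allow
      -- them to be cut off at `(r i)⁻¹`, which gives the bounds required of a weight on `ℤ × I`.
      refine ⟨fun p => w (-p.1) p.2 ⊓ (r (-p.1))⁻¹, ⟨fun i => ?_, ⟨ρ⁻¹, fun i α => ?_⟩,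
        fun ε hε => ?_⟩, fun x hx i => ?_⟩
      · exact h.mem_of_le (hw (-i)) fun α => inf_le_left
      · exact inf_le_right.trans (inv_anti₀ hρ (hρr _))
      · obtain ⟨i₀, hi₀⟩ := hr ε⁻¹
        refine ⟨-i₀, fun i hi α => inf_le_right.trans ?_⟩
        exact inv_le_of_inv_le₀ hε (hi₀ _ (by dsimp only; omega))
      · refine h.weightLattice_inf_le hn (hρ.trans_le (hρr i)) (hwM i) (hrM i) fun α => ?_
        simpa [curlyCoeff_apply] using hx (i, α)
    · rintro w ⟨hw, ⟨C, hC⟩, h0⟩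
      refine ⟨_, ⟨fun i => weightLattice c fun α => w (-i, α),
        fun i => h.isOpen_weightLattice (hw (-i)), ?_, fun ρ => ?_, rfl⟩, fun x hx p => hx p.1 p.2⟩
      · refine ⟨(C + 1 : ℝ≥0)⁻¹, by positivity, fun i =>
          closedBall_subset_weightLattice hn (a := C) (fun α => hC _ α) ?_⟩
        rw [← NNReal.coe_inv, Real.toNNReal_coe, ← div_eq_mul_inv]
        exact div_le_one_of_le₀ (by simp) zero_le
      · obtain ⟨N, hN⟩ := h0 (ρ.toNNReal + 1)⁻¹ (by positivity)
        refine ⟨-N + 1, fun i hi => closedBall_subset_weightLattice hn (hN (-i) (by omega)) ?_⟩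
        rw [mul_comm, ← div_eq_mul_inv]
        exact div_le_one_of_le₀ (by simp) zero_le

/-- If a form `π` on `R` satisfies `π (x * y) = ∑ x α * y (-α)`, then so does the form
`x ↦ π (x 0)` on `R{{t}}`. -/
theorem IsKotheSpace.hasSum_curly [CompleteSpace K] (h : IsKotheSpace τ V c) (hn : IsSupNorm c)
    {π : R →ₗ[K] K} (hπ : ∀ x y, HasSum (fun α => c x α * c y (-α)) (π (x * y)))
    (hπn : ∀ x, ‖π x‖ ≤ ‖x‖) (x y : Curly R) :
    HasSum (fun p => curlyCoeff c x p * curlyCoeff c y (-p)) (π ((x * y).coeff 0)) := by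
  have h1 := ((h.curly hn).summable_pairing x y).hasSum
  have h2 := h1.prod_fiberwise fun i => hπ (x.coeff i) (y.coeff (-i))
  rwa [← h2.unique (Curly.hasSum_map hπn x y)]

end CurlyStep

/-! ### The Köthe space `R((t))` -/

section LaurentStep

universe u

variable {K : Type u} [NontriviallyNormedField K] {I : Type*}
  {R : Type u} [CommRing R] [Algebra K R]

/-- The coefficients of a Laurent series with coefficients in `R`, indexed by `ℤ × I`. -/
def laurentCoeff (c : R →ₗ[K] I → K) : LaurentSeries R →ₗ[K] ℤ × I → K where
  toFun x p := c (x.coeff p.1) p.2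
  map_add' x y := by
    ext p
    simp
  map_smul' a x := by
    ext p
    simp

theorem laurentCoeff_apply (c : R →ₗ[K] I → K) (x : LaurentSeries R) (i : ℤ) (α : I) :
    laurentCoeff c x (i, α) = c (x.coeff i) α := rfl

variable [IsUltrametricDist K] [InvolutiveNeg I] [τ : TopologicalSpace R]
  {V : Set (I → ℝ≥0)} {c : R →ₗ[K] I → K}

/-- If `R` is a Köthe space, then so is `R((t))` with its higher topology. -/
theorem IsKotheSpace.laurent (h : IsKotheSpace τ V c) :
    IsKotheSpace (laurentFilterBasis K R).topology (laurentWeights V) (laurentCoeff c) where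
  polar_eq := polar_laurentWeights h.polar_eq
  injective x y hxy :=
    HahnSeries.ext (funext fun i => h.injective (funext fun α => congrFun hxy (i, α)))
  exists_iff f := by
    constructor
    · rintro ⟨x, rfl⟩
      refine ⟨fun i => h.nnnorm_mem (x.coeff i), x.order, fun i hi α => ?_⟩
      change ‖c (x.coeff i) α‖₊ = 0
      rw [HahnSeries.coeff_eq_zero_of_lt_order hi, map_zero, Pi.zero_apply, nnnorm_zero]
    · rintro ⟨hf, N, hN⟩
      choose x hx using fun i => (h.exists_iff fun α => f (i, α)).2 (hf i)
      have hx0 : ∀ i < N, x i = 0 := fun i hi => h.injective <| funext fun α => by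
        rw [hx, map_zero]
        exact nnnorm_eq_zero.1 (hN i hi α)
      refine ⟨HahnSeries.ofSuppBddBelow x ⟨N, fun i hi => ?_⟩,
        funext fun p => congrFun (hx p.1) p.2⟩
      by_contra! hlt
      exact hi (hx0 i hlt)
  isTopologicalAddGroup := (laurentFilterBasis K R).isTopologicalAddGroup
  hasBasis := by
    refine (laurentFilterBasis K R).nhds_zero_hasBasis.to_hasBasis ?_ ?_
    · rintro _ ⟨M, hM, ⟨i₀, hi₀⟩, rfl⟩
      have hw : ∀ i, ∃ w ∈ V, weightLattice c w ≤ M i ∧ (i₀ ≤ i → w = 0) := by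
        intro i
        by_cases hi : i₀ ≤ i
        · exact ⟨0, h.mem_of_finite (by simp), by simp [hi₀ i hi], fun _ => rfl⟩
        · obtain ⟨w, hw, hwM⟩ := h.exists_weightLattice_le (hM i)
          exact ⟨w, hw, hwM, fun h => absurd h hi⟩
      choose w hw hwM hw0 using hw
      refine ⟨fun p => w (-p.1) p.2, ⟨fun i => hw (-i), -i₀, fun i hi α => ?_⟩,
        fun x hx i => hwM i fun α => ?_⟩
      · exact congrFun (hw0 (-i) (by omega)) α
      · simpa [laurentCoeff_apply] using hx (i, α)
    · rintro w ⟨hw, N, hN⟩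
      refine ⟨_, ⟨fun i => weightLattice c fun α => w (-i, α),
        fun i => h.isOpen_weightLattice (hw (-i)), ⟨-N + 1, fun i hi => ?_⟩, rfl⟩,
        fun x hx p => hx p.1 p.2⟩
      refine eq_top_iff.2 fun x _ α => ?_
      dsimp only
      rw [hN (-i) (by omega), zero_mul]
      exact zero_le

/-- If a form `π` on `R` satisfies `π (x * y) = ∑ x α * y (-α)`, then so does the form
`x ↦ π (x 0)` on `R((t))`. -/
theorem IsKotheSpace.hasSum_laurent [CompleteSpace K] (h : IsKotheSpace τ V c)
    {π : R →ₗ[K] K} (hπ : ∀ x y, HasSum (fun α => c x α * c y (-α)) (π (x * y)))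
    (x y : LaurentSeries R) :
    HasSum (fun p => laurentCoeff c x p * laurentCoeff c y (-p)) (π ((x * y).coeff 0)) := by
  classical
  have h1 := (h.laurent.summable_pairing x y).hasSum
  have h2 := h1.prod_fiberwise fun i => hπ (x.coeff i) (y.coeff (-i))
  have h3 : HasSum (fun i => π (x.coeff i * y.coeff (-i))) (π ((x * y).coeff 0)) := by
    have hsnd : ∀ ij ∈ Finset.antidiagonal x.isPWO_support y.isPWO_support 0,
        ij.2 = -ij.1 := fun ij hij =>
      eq_neg_of_add_eq_zero_right (Finset.mem_antidiagonal.1 hij).2.2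
    have heq : π ((x * y).coeff 0) =
        ∑ i ∈ (Finset.antidiagonal x.isPWO_support y.isPWO_support 0).image Prod.fst,
          π (x.coeff i * y.coeff (-i)) := by
      rw [HahnSeries.coeff_mul, map_sum, Finset.sum_image]
      · exact Finset.sum_congr rfl fun ij hij => by rw [hsnd ij hij]
      · intro p hp q hq hpq
        exact Prod.ext hpq (by rw [hsnd p hp, hsnd q hq, hpq])
    rw [heq]
    refine hasSum_sum_of_ne_finset_zero fun i hi => ?_
    by_contra hne
    refine hi (Finset.mem_image.2 ⟨(i, -i), Finset.mem_antidiagonal.2 ⟨?_, ?_, ?_⟩, rfl⟩)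
    · intro h0
      simp [h0] at hne
    · intro h0
      simp [h0] at hne
    · simp
  rwa [← h2.unique h3]

end LaurentStep

/-! ### The standard fields -/

section Tower

universe u

variable {K : Type u} [NontriviallyNormedField K] [IsUltrametricDist K]

/-- `R` is a Köthe space with self-polar weights, on which `coeffZero (x * y)` is the pairing
`∑ x α * y (-α)`. -/
def Level.IsKothe (R : Level K) : Prop :=
  ∃ (I : Type) (_ : InvolutiveNeg I) (V : Set (I → ℝ≥0)) (c : R →ₗ[K] I → K),
    IsKotheSpace R.higherTopology V c ∧
    ∀ x y : R, HasSum (fun α => c x α * c y (-α)) (R.coeffZero (x * y))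

/-- The condition `Level.IsKothe`, where moreover the norm is the supremum of the norms of the
coefficients, and bounds `coeffZero`. -/
def NormedLevel.IsKothe (R : NormedLevel K) : Prop :=
  ∃ (I : Type) (_ : InvolutiveNeg I) (V : Set (I → ℝ≥0)) (c : R.carrier →ₗ[K] I → K),
    IsKotheSpace R.higherTopology V c ∧
    (∀ x y : R.carrier, HasSum (fun α => c x α * c y (-α)) (R.coeffZero (x * y))) ∧
    IsSupNorm c ∧ ∀ x, ‖R.coeffZero x‖ ≤ ‖x‖

theorem NormedLevel.IsKothe.toLevel {R : NormedLevel K} (h : R.IsKothe) : R.toLevel.IsKothe := by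
  obtain ⟨I, _, V, c, h, hπ, -⟩ := h
  exact ⟨I, inferInstance, V, c, h, hπ⟩

theorem NormedLevel.IsKothe.curly [CompleteSpace K] {R : NormedLevel K} (h : R.IsKothe) :
    R.curly.IsKothe := by
  obtain ⟨I, _, V, c, h, hπ, hn, hπn⟩ := h
  exact ⟨ℤ × I, inferInstance, curlyWeights V, curlyCoeff c, h.curly hn, h.hasSum_curly hn hπ hπn,
    hn.curly, fun x => (hπn _).trans (Curly.norm_coeff_le x 0)⟩

theorem Level.IsKothe.laurent [CompleteSpace K] {R : Level K} (h : R.IsKothe) :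
    R.laurent.IsKothe := by
  obtain ⟨I, _, V, c, h, hπ⟩ := h
  exact ⟨ℤ × I, inferInstance, laurentWeights V, laurentCoeff c, h.laurent, h.hasSum_laurent hπ⟩

variable (K) in
/-- The field `K` is the Köthe space of all families indexed by a point. -/
theorem isKotheSpace_self :
    IsKotheSpace (I := Unit) (inferInstance : TopologicalSpace K) Set.univ
      (LinearMap.pi fun _ => LinearMap.id) where
  polar_eq := Set.eq_univ_of_forall fun _ => mem_polar_of_finite (Set.toFinite _)
  injective x y h := congrFun h ()
  exists_iff f := by
    simp only [Set.mem_univ, iff_true]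
    exact ⟨f (), rfl⟩
  isTopologicalAddGroup := inferInstance
  hasBasis := by
    refine Metric.nhds_basis_closedBall.to_hasBasis (fun ε hε => ?_) fun w _ => ?_
    · lift ε to ℝ≥0 using hε.le
      rw [NNReal.coe_pos] at hε
      refine ⟨fun _ => ε⁻¹, trivial, fun x hx => ?_⟩
      have : ε⁻¹ * ‖x‖₊ ≤ 1 := hx ()
      rw [inv_mul_le_iff₀ hε, mul_one] at this
      exact mem_closedBall_zero_iff.2 this
    · refine ⟨(w () + 1 : ℝ≥0)⁻¹, by positivity, fun x hx α => ?_⟩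
      rw [mem_closedBall_zero_iff, ← NNReal.coe_inv, ← coe_nnnorm, NNReal.coe_le_coe] at hx
      calc w () * ‖x‖₊ ≤ (w () + 1) * (w () + 1)⁻¹ := mul_le_mul' (by simp) hx
        _ = 1 := mul_inv_cancel₀ (by positivity)

variable (K) [CompleteSpace K]

theorem isKothe_curlyTower (r : ℕ) : (curlyTower K r).IsKothe := by
  induction r with
  | zero =>
    refine ⟨Unit, inferInstance, Set.univ, _, isKotheSpace_self K, fun x y => ?_, fun x C => ?_,
      fun x => le_rfl⟩
    · exact hasSum_unique (β := Unit) fun _ => (x * y : K)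
    · exact (forall_const Unit).symm
  | succ r ih => exact ih.curly

theorem isKothe_standardField (r s : ℕ) : (standardField K r s).IsKothe := by
  induction s with
  | zero => exact (isKothe_curlyTower K r).toLevel
  | succ s ih => exact ih.laurent

end Tower

end HigherLocalField

theorem mainTheorem1 {K : Type*} [NontriviallyNormedField K] [IsUltrametricDist K]
    [ProperSpace K] [CharZero K] (r s : ℕ) :
    let F := HigherLocalField.standardField K r s
    HigherLocalField.IsLocallyConvex K F ∧
    HigherLocalField.IsLocallyConvex K (HigherLocalField.CDual K F) ∧
    ∃ γ : F ≃L[K] HigherLocalField.CDual K F,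
      ∀ x y : F, γ x y = F.coeffZero (x * y) := by
  intro F
  obtain ⟨I, _, V, c, h, hπ⟩ := HigherLocalField.isKothe_standardField K r s
  obtain ⟨γ, hγ⟩ := h.exists_equiv_cdual
  exact ⟨h.isLocallyConvex, h.isLocallyConvex.congr γ, γ,
    fun x y => (hγ x y).trans (hπ x y).tsum_eq⟩
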